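/- **Quantum Goldreich–Levin theorem.** Quantum circuits are finite sequences of arbitrary one- and two-qubit unitary gates, and the size of a circuit is its number of gates. For a circuit $C$ on $m$ qubits and a string $x\in\{0,1\}^n$ with $n\le m$, $C(x)$ denotes the result of measuring the first qubits of $C|x\rangle|0^{m-n}\rangle$ in the computational basis (the first $n$ qubits for a circuit that inverts or evaluates a function $\{0,1\}^n\to\{0,1\}^n$, the first qubit for a circuit that predicts a bit). Let $f:\{0,1\}^n\to\{0,1\}^n$ be a permutation. - $f$ is *quantumly $(\delta,T)$-hard to invert* if there is no quantum circuit $C$ of size at most $T$ with $\Pr_a[C(f(a))=a]\ge\delta$, where $a\in\{0,1\}^n$ is uniformly random. - Put $\tilde f(y,x)=(f(y),x)$ and $h(y,x)=y\cdot x$ (inner product modulo two) for $x,y\in\{0,1\}^n$. A quantum circuit $G$ *$(\delta,\varepsilon)$-predicts $h$ from $\tilde f$* if $$\Pr_y\Big[\Pr_x[G(\tilde f(y,x))=h(y,x)]\ge\tfrac12+\varepsilon\Big]\ge\delta ,$$ where $x,y$ are uniformly random; the inner probability is also over the measurement. Then there is an absolute constant $c>0$ such that the following holds for all $n$, all permutations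 $f$ of $\{0,1\}^n$, all real $\delta,\varepsilon$ and all $T\in\mathbb N$. Suppose that $f$ is quantumly $(\delta/2,T)$-hard to invert, and let $F$ be any quantum circuit, of size $S$, that computes $f$ (that is, $F(x)=f(x)$ with certainty for every $x$). Then every quantum circuit $G$ that $(\delta,\varepsilon)$-predicts $h$ from $\tilde f$ satisfies $$\mathrm{size}(G)+S\ \ge\ c\,T\varepsilon .$$ In particular, if $f$ is easy to compute in the sense that $S\le\tfrac c2\,T\varepsilon$, then $\mathrm{size}(G)\ge\tfrac c2\,T\varepsilon$, i.e. $G$ has size $\Omega(T\varepsilon)$, so that the dilution factor is $O(1/\varepsilon)$. -/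

import Mathlib

namespace QuantumGL

/-- Bit strings of length `n`; a bit is an element of `ZMod 2`, so that the inner product modulo two
of `y` and `x` is the dot product `y ⬝ᵥ x`. -/
abbrev Bits (n : ℕ) : Type := Fin n → ZMod 2

/-- A (not necessarily normalised) state vector of `m` qubits: an amplitude for every string. -/
abbrev QState (m : ℕ) : Type := Bits m → ℂ

/-- The computational basis state `|s⟩`. -/
def ket {m : ℕ} (s : Bits m) : QState m := fun x => if x = s then 1 else 0

/-- An elementary gate on `m` qubits: an arbitrary unitary on one qubit, or on two distinct
qubits. -/
inductive Gate (m : ℕ) : Type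
  | one (i : Fin m) (U : Matrix.unitaryGroup (ZMod 2) ℂ) : Gate m
  | two (i j : Fin m) (hij : i ≠ j) (U : Matrix.unitaryGroup (ZMod 2 × ZMod 2) ℂ) : Gate m

/-- The action of a gate on state vectors (the unitary acts on the named qubits, the identity acts
on all others). -/
noncomputable def Gate.apply {m : ℕ} : Gate m → QState m → QState m
  | .one i U, ψ => fun x =>
      ∑ c : ZMod 2, (U : Matrix (ZMod 2) (ZMod 2) ℂ) (x i) c * ψ (Function.update x i c)
  | .two i j _ U, ψ => fun x =>
      ∑ c : ZMod 2, ∑ d : ZMod 2,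
        (U : Matrix (ZMod 2 × ZMod 2) (ZMod 2 × ZMod 2) ℂ) (x i, x j) (c, d) *
          ψ (Function.update (Function.update x i c) j d)

/-- A quantum circuit on `m` qubits: the list of its gates, in the order in which they are
applied. -/
abbrev Circuit (m : ℕ) : Type := List (Gate m)

/-- The size of a circuit is its number of gates. -/
def Circuit.size {m : ℕ} (C : Circuit m) : ℕ := List.length C

/-- The unitary transformation computed by a circuit, applied to a state vector. -/
noncomputable def Circuit.run {m : ℕ} (C : Circuit m) (ψ : QState m) : QState m :=
  List.foldl (fun φ g => Gate.apply g φ) ψ C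

/-- The string `x` followed by zeros (used for `n ≤ m` only): the input `|x⟩|0^(m-n)⟩`. -/
def padZero {n : ℕ} (m : ℕ) (x : Bits n) : Bits m :=
  fun i => if h : (i : ℕ) < n then x ⟨i, h⟩ else 0

/-- The probability that measuring the first `k` of the `m` qubits of `C|x⟩|0^(m-n)⟩` in the
computational basis yields `z`. -/
noncomputable def Circuit.outProb {m n k : ℕ} (C : Circuit m) (_hn : n ≤ m) (hk : k ≤ m)
    (x : Bits n) (z : Bits k) : ℝ :=
  ∑ w : Bits m, if (∀ i : Fin k, w (Fin.castLE hk i) = z i) then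
    ‖Circuit.run C (ket (padZero m x)) w‖ ^ 2 else 0

/-- The circuit `C` computes `f`: on input `x` its output is `f x` with certainty. -/
def Circuit.Computes {m n : ℕ} (C : Circuit m) (hm : n ≤ m) (f : Bits n → Bits n) : Prop :=
  ∀ x : Bits n, Circuit.outProb C hm hm x (f x) = 1

/-- `Pr_a[C(f(a)) = a]`, for a uniformly random `a`. -/
noncomputable def Circuit.invProb {m n : ℕ} (C : Circuit m) (hm : n ≤ m)
    (f : Equiv.Perm (Bits n)) : ℝ :=
  (∑ a : Bits n, Circuit.outProb C hm hm (f a) a) / 2 ^ n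

/-- The permutation `f` is quantumly `(δ, T)`-hard to invert: no quantum circuit of size (at most)
`T`, with any number of auxiliary qubits, satisfies `Pr_a[C(f(a)) = a] ≥ δ`. -/
def QHardToInvert {n : ℕ} (f : Equiv.Perm (Bits n)) (δ : ℝ) (T : ℕ) : Prop :=
  ¬ ∃ (m : ℕ) (hm : n ≤ m) (C : Circuit m), Circuit.size C ≤ T ∧ δ ≤ Circuit.invProb C hm f

/-- The predicate `h(y, x) = y · x`. -/
def hardPred {n : ℕ} (y x : Bits n) : ZMod 2 := y ⬝ᵥ x

/-- The permutation `(y, x) ↦ (f y, x)`. -/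
def tildeMap {n : ℕ} (f : Equiv.Perm (Bits n)) : Equiv.Perm (Bits n × Bits n) :=
  Equiv.prodCongr f (Equiv.refl (Bits n))

/-- `Pr_x[G(f̃(y, x)) = h(y, x)]` for a uniformly random `x`, where `G` takes the two strings of
`f̃(y, x)` one after the other as its input, and outputs one bit. -/
noncomputable def Circuit.predProb {m n : ℕ} (G : Circuit m) (hm : n + n ≤ m) (hm₁ : 1 ≤ m)
    (f : Equiv.Perm (Bits n)) (y : Bits n) : ℝ :=
  (∑ x : Bits n, Circuit.outProb G hm hm₁
    (Fin.append (tildeMap f (y, x)).1 (tildeMap f (y, x)).2) (fun _ => hardPred y x)) / 2 ^ n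

/-- The circuit `G` `(δ, ε)`-predicts `h` from `f̃`:
`Pr_y[Pr_x[G(f̃(y, x)) = h(y, x)] ≥ 1/2 + ε] ≥ δ`. -/
def Circuit.Predicts {m n : ℕ} (G : Circuit m) (hm : n + n ≤ m) (hm₁ : 1 ≤ m)
    (f : Equiv.Perm (Bits n)) (δ ε : ℝ) : Prop :=
  δ ≤ (Set.ncard {y : Bits n | 1 / 2 + ε ≤ Circuit.predProb G hm hm₁ f y} : ℝ) / 2 ^ n

end QuantumGL

/-!
The inverter is the Goldreich–Levin decoder with the predictor `G` in the role of a phase oracle: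
Hadamard gates on the candidate, `G` conjugating a Pauli `Z` on its output qubit, and Hadamard
gates again turn the zero candidate into the preimage `a` of the target with an amplitude equal to
the bias `2 Pr_x[G(f a, x) = a ⬝ᵥ x] - 1 ≥ 2 ε`. The evaluator `F` recognises the preimage, so
amplitude amplification raises the success probability after `O(1 / ε)` iterations.

Two points need care. The cost of an iteration must be `O(size G + size F)`, independently of `n`:
a bit touched neither by `F` nor by `G` in its second input vanishes in each string on which `G`
has a bias, and `f` leaves it unchanged, so only the set `B` of the remaining bits is ever used.
Also, the number `j` of iterations must serve all `a` at once, although the biases differ. An extra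
flag keeps the initial success probability `sin² θ` at most `1 / 2`, so that `4 θ ≤ π`, and an
average over `j` with the Perron eigenvector of a path as weights then gives success probability at
least `1 / 2` for each `θ` in the range, hence a common `j` which is good on average over `a`.
-/

namespace QuantumGL

open Matrix

section Signs

/-- The sign `(-1)^a` of a bit, as an additive character. -/
noncomputable def sgn : AddChar (ZMod 2) ℂ := AddChar.zmodChar 2 (neg_one_sq : (-1 : ℂ) ^ 2 = 1)

lemma sgn_one : sgn 1 = -1 := by
  simp [sgn, AddChar.zmodChar_apply, show (1 : ZMod 2).val = 1 from rfl]

lemma zmod_two_cases (a : ZMod 2) : a = 0 ∨ a = 1 := by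
  revert a; decide

lemma sum_zmod_two {M : Type*} [AddCommMonoid M] (φ : ZMod 2 → M) : ∑ c, φ c = φ 0 + φ 1 :=
  Fin.sum_univ_two φ

lemma star_sgn (a : ZMod 2) : star (sgn a) = sgn a := by
  rcases zmod_two_cases a with rfl | rfl <;> simp [sgn_one]

lemma sgn_mul_self (a : ZMod 2) : sgn a * sgn a = 1 := by
  rw [← AddChar.map_add_eq_mul, CharTwo.add_self_eq_zero, AddChar.map_zero_eq_one]

end Signs

/-! ### Registers -/

/-- A register of a system with configurations `X`: a part of the configuration with values in `α`
which can be read and overwritten independently of the rest. The qubits on which a gate acts form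
a register. -/
structure Register (X α : Type*) where
  read : X → α
  write : X → α → X
  read_write : ∀ x a, read (write x a) = a
  write_read : ∀ x, write x (read x) = x
  write_write : ∀ x a b, write (write x a) b = write x b

namespace Register

/-- The register consisting of one coordinate. -/
def coord {ι β : Type*} [DecidableEq ι] (i : ι) : Register (ι → β) β where
  read x := x i
  write x a := Function.update x i a
  read_write := by simp
  write_read := by simp
  write_write := by simp

/-- The register consisting of two distinct coordinates. -/
def pair {ι β : Type*} [DecidableEq ι] (i j : ι) (hij : i ≠ j) : Register (ι → β) (β × β) where
  read x := (x i, x j)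
  write x a := Function.update (Function.update x i a.1) j a.2
  read_write := by simp [hij]
  write_read := by simp
  write_write x a b := by rw [Function.update_comm hij]; simp [Function.update_comm hij]

variable {X α : Type*} (r : Register X α)

/-- Exchanges the content of the register with an external value. -/
def exchange : Equiv.Perm (X × α) :=
  Function.Involutive.toPerm (fun p => (r.write p.1 p.2, r.read p.1)) fun p => by
    simp [r.write_write, r.read_write, r.write_read]

lemma exchange_apply (p : X × α) : r.exchange p = (r.write p.1 p.2, r.read p.1) := rfl

variable [Fintype α]

/-- The operator on states over `X` that applies a matrix to a register and the identity to the
rest of the system. -/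
def act (U : Matrix α α ℂ) : (X → ℂ) →ₗ[ℂ] X → ℂ where
  toFun ψ x := ∑ a, U (r.read x) a * ψ (r.write x a)
  map_add' ψ φ := by ext x; simp [mul_add, Finset.sum_add_distrib]
  map_smul' c ψ := by ext x; simp [Finset.mul_sum, mul_left_comm]

lemma act_apply (U : Matrix α α ℂ) (ψ : X → ℂ) (x : X) :
    r.act U ψ x = ∑ a, U (r.read x) a * ψ (r.write x a) := rfl

lemma act_one [DecidableEq α] (ψ : X → ℂ) : r.act 1 ψ = ψ := by
  ext x
  simp [act_apply, Matrix.one_apply, r.write_read]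

lemma act_act (U V : Matrix α α ℂ) (ψ : X → ℂ) : r.act U (r.act V ψ) = r.act (U * V) ψ := by
  ext x
  simp only [act_apply, Matrix.mul_apply, Finset.mul_sum, Finset.sum_mul, r.read_write,
    r.write_write, mul_assoc]
  exact Finset.sum_comm

lemma star_act_dotProduct [Fintype X] (U : Matrix α α ℂ) (ψ φ : X → ℂ) :
    star (r.act U ψ) ⬝ᵥ φ = star ψ ⬝ᵥ r.act Uᴴ φ := by
  simp only [dotProduct, Pi.star_apply, act_apply, star_sum, Finset.sum_mul, Finset.mul_sum,
    ← Fintype.sum_prod_type' (f := fun _ _ => _ * _)]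
  refine Fintype.sum_equiv r.exchange _ _ fun p => ?_
  simp only [exchange_apply, r.read_write, r.write_write, r.write_read,
    conjTranspose_apply, star_mul']
  ring

variable [DecidableEq X]

lemma act_single (U : Matrix α α ℂ) (u : X) :
    r.act U (Pi.single u 1) = ∑ a, U a (r.read u) • Pi.single (r.write u a) 1 := by
  ext x
  obtain ⟨P, hP⟩ : ∃ P : Prop, x = r.write u (r.read x) ↔ P := ⟨_, Iff.rfl⟩
  have write_eq (a : α) : r.write x a = u ↔ a = r.read u ∧ P := by
    rw [← hP]
    constructor
    · rintro rfl
      simp [r.read_write, r.write_write, r.write_read]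
    · rintro ⟨rfl, h⟩
      rw [h, r.write_write, r.write_read]
  have eq_write (a : α) : x = r.write u a ↔ a = r.read x ∧ P := by
    rw [← hP]
    constructor
    · rintro rfl
      simp [r.read_write]
    · rintro ⟨rfl, h⟩
      exact h
  classical
  simp [act_apply, Pi.single_apply, write_eq, eq_write, ite_and]

variable [DecidableEq α]

lemma act_diagonal_single (d : α → ℂ) (u : X) :
    r.act (diagonal d) (Pi.single u 1) = d (r.read u) • Pi.single u 1 := by
  simp [act_single, diagonal_apply, r.write_read]

lemma act_permMatrix_single (σ : Equiv.Perm α) (u : X) :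
    r.act (σ.permMatrix ℂ) (Pi.single u 1) = Pi.single (r.write u (σ.symm (r.read u))) 1 := by
  simp [act_single, Equiv.Perm.permMatrix, PEquiv.toMatrix_apply, ← Equiv.eq_symm_apply]

end Register

/-! ### Gates -/

section Gates

variable {m : ℕ}

lemma ket_eq_single (s : Bits m) : ket s = Pi.single s 1 := by
  ext x
  simp [ket, Pi.single_apply]

lemma extend_comp_self {ι κ β : Type*} (e : κ ↪ ι) (w : ι → β) :
    Function.extend e (w ∘ e) w = w := by
  ext q
  by_cases hq : ∃ j, e j = q
  · obtain ⟨j, rfl⟩ := hq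
    exact e.injective.extend_apply _ _ j
  · exact Function.extend_apply' _ _ _ hq

lemma extend_extend {ι κ β : Type*} (e : κ ↪ ι) (u v : κ → β) (w : ι → β) :
    Function.extend e u (Function.extend e v w) = Function.extend e u w := by
  ext q
  by_cases hq : ∃ j, e j = q
  · obtain ⟨j, rfl⟩ := hq
    simp [e.injective.extend_apply]
  · simp [Function.extend_apply' _ _ _ hq]

namespace Gate

lemma apply_one_eq_act (i : Fin m) (U : Matrix.unitaryGroup (ZMod 2) ℂ) (ψ : QState m) :
    (Gate.one i U).apply ψ = (Register.coord i).act U ψ := rfl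

lemma apply_two_eq_act {i j : Fin m} (hij : i ≠ j)
    (U : Matrix.unitaryGroup (ZMod 2 × ZMod 2) ℂ) (ψ : QState m) :
    (Gate.two i j hij U).apply ψ = (Register.pair i j hij).act U ψ := by
  ext x
  simp only [Gate.apply, Register.act_apply, Fintype.sum_prod_type]
  rfl

lemma isLinearMap_apply (g : Gate m) : IsLinearMap ℂ g.apply := by
  cases g with
  | one i U => exact ((Register.coord i).act U.1).isLinear
  | two i j hij U =>
    rw [funext (apply_two_eq_act hij U)]
    exact ((Register.pair i j hij).act U.1).isLinear

/-- The inverse gate. -/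
def inv : Gate m → Gate m
  | .one i U => .one i U⁻¹
  | .two i j hij U => .two i j hij U⁻¹

lemma inv_inv (g : Gate m) : g.inv.inv = g := by
  cases g <;> simp [inv]

lemma apply_inv_apply (g : Gate m) (ψ : QState m) : g.inv.apply (g.apply ψ) = ψ := by
  cases g with
  | one i U =>
    simp only [inv, apply_one_eq_act, Register.act_act, ← UnitaryGroup.mul_val, inv_mul_cancel,
      UnitaryGroup.one_val, Register.act_one]
  | two i j hij U =>
    simp only [inv, apply_two_eq_act, Register.act_act, ← UnitaryGroup.mul_val, inv_mul_cancel,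
      UnitaryGroup.one_val, Register.act_one]

lemma star_apply_dotProduct (g : Gate m) (ψ φ : QState m) :
    star (g.apply ψ) ⬝ᵥ φ = star ψ ⬝ᵥ g.inv.apply φ := by
  cases g with
  | one i U =>
    simp only [inv, apply_one_eq_act, Register.star_act_dotProduct]
    rfl
  | two i j hij U =>
    simp only [inv, apply_two_eq_act, Register.star_act_dotProduct]
    rfl

/-- The set of the qubits on which a gate acts. -/
def touched : Gate m → Finset (Fin m)
  | .one i _ => {i}
  | .two i j _ _ => {i, j}

lemma card_touched_le (g : Gate m) : g.touched.card ≤ 2 := by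
  cases g with
  | one i U => simp [touched]
  | two i j hij U => exact Finset.card_le_two

lemma eqOn_of_apply_ket_ne_zero (g : Gate m) {u w : Bits m} (h : g.apply (ket u) w ≠ 0) :
    Set.EqOn u w (g.touched : Set (Fin m))ᶜ := by
  cases g with
  | one i U =>
    rw [apply_one_eq_act, ket_eq_single, Register.act_single, Finset.sum_apply] at h
    obtain ⟨a, -, ha⟩ := Finset.exists_ne_zero_of_sum_ne_zero h
    obtain rfl : w = Function.update u i a := by
      by_contra hne
      exact ha (by simp [Register.coord, hne])
    intro q hq
    simp_all [touched]
  | two i j hij U =>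
    rw [apply_two_eq_act, ket_eq_single, Register.act_single, Finset.sum_apply] at h
    obtain ⟨a, -, ha⟩ := Finset.exists_ne_zero_of_sum_ne_zero h
    obtain rfl : w = Function.update (Function.update u i a.1) j a.2 := by
      by_contra hne
      exact ha (by simp [Register.pair, hne])
    intro q hq
    simp_all [touched]

lemma apply_translate (g : Gate m) {d : Bits m} (hd : ∀ q ∈ g.touched, d q = 0) (ψ : QState m) :
    g.apply (fun v => ψ (v + d)) = fun w => g.apply ψ (w + d) := by
  have update_add_eq (w : Bits m) {i : Fin m} (hi : d i = 0) (c : ZMod 2) :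
      Function.update w i c + d = Function.update (w + d) i c := by
    rw [← congrArg (Function.update (w + d) i) (add_zero c), Function.update_add,
      ← hi, Function.update_eq_self]
  ext w
  cases g with
  | one i U =>
    have hi : d i = 0 := hd i (by simp [touched])
    simp only [Gate.apply, update_add_eq _ hi, Pi.add_apply, hi, add_zero]
  | two i j hij U =>
    have hi : d i = 0 := hd i (by simp [touched])
    have hj : d j = 0 := hd j (by simp [touched])
    simp only [Gate.apply, update_add_eq _ hi, update_add_eq _ hj, Pi.add_apply, hi, hj, add_zero]

/-- The same gate on a larger system, in which the `i`-th qubit has the number `e i`. -/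
def relabel {M : ℕ} (e : Fin m ↪ Fin M) : Gate m → Gate M
  | .one i U => .one (e i) U
  | .two i j hij U => .two (e i) (e j) (e.injective.ne hij) U

lemma touched_relabel {M : ℕ} (e : Fin m ↪ Fin M) (g : Gate m) :
    (g.relabel e).touched = g.touched.map e := by
  cases g <;> simp [touched, relabel, Finset.map_insert]

lemma apply_relabel {M : ℕ} (e : Fin m ↪ Fin M) (g : Gate m) (ψ : QState M) (w : Bits M) :
    (g.relabel e).apply ψ w = g.apply (fun u => ψ (Function.extend e u w)) (w ∘ e) := by
  have extend_update (u : Bits m) (i : Fin m) (c : ZMod 2) :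
      Function.extend e (Function.update u i c) w =
        Function.update (Function.extend e u w) (e i) c := by
    classical
    ext q
    by_cases hq : ∃ j, e j = q
    · obtain ⟨j, rfl⟩ := hq
      simp [e.injective.extend_apply, Function.update_apply]
    · have hne : q ≠ e i := fun h => hq ⟨i, h.symm⟩
      simp [Function.extend_apply' _ _ _ hq, hne]
  cases g <;> simp [relabel, Gate.apply, extend_update, extend_comp_self]

end Gate

end Gates

/-! ### Circuits -/

section Circuits

variable {m : ℕ}

lemma star_ket_dotProduct (s : Bits m) (ψ : QState m) : star (ket s) ⬝ᵥ ψ = ψ s := by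
  simp [ket_eq_single]

lemma sum_smul_ket (ψ : QState m) : ∑ w, ψ w • ket w = ψ := by
  ext x
  simp [ket]

lemma star_dotProduct_self (ψ : QState m) : star ψ ⬝ᵥ ψ = ((∑ w, ‖ψ w‖ ^ 2 : ℝ) : ℂ) := by
  simp [dotProduct, ← Complex.conj_mul']

namespace Circuit

lemma run_nil (ψ : QState m) : run [] ψ = ψ := rfl

lemma run_cons (g : Gate m) (C : Circuit m) (ψ : QState m) :
    run (g :: C) ψ = run C (g.apply ψ) := rfl

lemma run_append (C D : Circuit m) (ψ : QState m) : run (C ++ D) ψ = run D (run C ψ) :=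
  List.foldl_append

lemma isLinearMap_run (C : Circuit m) : IsLinearMap ℂ (run C) := by
  induction C with
  | nil => exact LinearMap.id.isLinear
  | cons g C ih => exact ((ih.mk' _).comp (g.isLinearMap_apply.mk' _)).isLinear

lemma run_smul (C : Circuit m) (a : ℂ) (ψ : QState m) : run C (a • ψ) = a • run C ψ :=
  C.isLinearMap_run.map_smul a ψ

lemma run_sub (C : Circuit m) (ψ φ : QState m) : run C (ψ - φ) = run C ψ - run C φ :=
  C.isLinearMap_run.map_sub ψ φ

lemma run_sum {α : Type*} (C : Circuit m) (s : Finset α) (ψ : α → QState m) :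
    run C (∑ i ∈ s, ψ i) = ∑ i ∈ s, run C (ψ i) :=
  map_sum (C.isLinearMap_run.mk' _) ψ s

lemma run_apply_eq_sum (C : Circuit m) (ψ : QState m) (w : Bits m) :
    run C ψ w = ∑ v, ψ v * run C (ket v) w := by
  conv_lhs => rw [← sum_smul_ket ψ, run_sum]
  simp [run_smul]

lemma exists_run_ket_ne_zero {C : Circuit m} {ψ : QState m} {w : Bits m} (h : run C ψ w ≠ 0) :
    ∃ v, ψ v ≠ 0 ∧ run C (ket v) w ≠ 0 := by
  rw [run_apply_eq_sum] at h
  obtain ⟨v, -, hv⟩ := Finset.exists_ne_zero_of_sum_ne_zero h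
  exact ⟨v, left_ne_zero_of_mul hv, right_ne_zero_of_mul hv⟩

lemma run_eq_mul_of_ket {C : Circuit m} {ψ : QState m} {d : Bits m → ℂ}
    (h : ∀ u, ψ u ≠ 0 → run C (ket u) = d u • ket u) : run C ψ = fun w => d w * ψ w := by
  ext w
  have smul_run (v : Bits m) : ψ v * run C (ket v) w = d v * ψ v * ket v w := by
    by_cases hv : ψ v = 0
    · simp [hv]
    · rw [h v hv, Pi.smul_apply, smul_eq_mul]
      ring
  simp [run_apply_eq_sum C ψ, smul_run, ket]

/-- The inverse circuit. -/
def inv (C : Circuit m) : Circuit m := (C.map Gate.inv).reverse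

lemma length_inv (C : Circuit m) : C.inv.length = C.length := by simp [inv]

lemma inv_cons (g : Gate m) (C : Circuit m) : inv (g :: C) = inv C ++ [g.inv] := by simp [inv]

lemma inv_inv (C : Circuit m) : C.inv.inv = C := by
  simp [inv, Function.comp_def, Gate.inv_inv]

lemma run_inv_run (C : Circuit m) (ψ : QState m) : run C.inv (run C ψ) = ψ := by
  induction C generalizing ψ with
  | nil => rfl
  | cons g C ih => rw [inv_cons, run_append, run_cons g C, ih, run_cons, run_nil, g.apply_inv_apply]

lemma run_run_inv (C : Circuit m) (ψ : QState m) : run C (run C.inv ψ) = ψ := by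
  simpa only [inv_inv] using run_inv_run C.inv ψ

lemma star_run_dotProduct (C : Circuit m) (ψ φ : QState m) :
    star (run C ψ) ⬝ᵥ φ = star ψ ⬝ᵥ run C.inv φ := by
  induction C generalizing ψ with
  | nil => rfl
  | cons g C ih => rw [run_cons, ih, g.star_apply_dotProduct, inv_cons, run_append]; rfl

lemma star_run_dotProduct_run (C : Circuit m) (ψ φ : QState m) :
    star (run C ψ) ⬝ᵥ run C φ = star ψ ⬝ᵥ φ := by
  rw [star_run_dotProduct, run_inv_run]

lemma run_inv_ket_apply (C : Circuit m) (u w : Bits m) :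
    run C.inv (ket u) w = star (run C (ket w) u) := by
  rw [← star_ket_dotProduct w (run C.inv (ket u)), ← star_run_dotProduct, star_dotProduct,
    star_ket_dotProduct]

lemma sum_sq_norm_run (C : Circuit m) (ψ : QState m) :
    ∑ w, ‖run C ψ w‖ ^ 2 = ∑ w, ‖ψ w‖ ^ 2 := by
  exact_mod_cast (star_dotProduct_self (run C ψ)).symm.trans
    ((C.star_run_dotProduct_run ψ ψ).trans (star_dotProduct_self ψ))

/-- The set of the qubits on which some gate of a circuit acts. -/
def touched (C : Circuit m) : Finset (Fin m) := C.foldr (fun g S => g.touched ∪ S) ∅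

lemma touched_cons (g : Gate m) (C : Circuit m) : touched (g :: C) = g.touched ∪ touched C := rfl

lemma card_touched_le (C : Circuit m) : C.touched.card ≤ 2 * C.length := by
  induction C with
  | nil => simp [touched]
  | cons g C ih =>
    rw [touched_cons, List.length_cons]
    linarith [Finset.card_union_le g.touched (touched C), g.card_touched_le]

lemma run_translate (C : Circuit m) {d : Bits m} (hd : ∀ q ∈ C.touched, d q = 0) (ψ : QState m) :
    run C (fun v => ψ (v + d)) = fun w => run C ψ (w + d) := by
  induction C generalizing ψ with
  | nil => rfl
  | cons g C ih =>
    simp only [touched_cons, Finset.mem_union] at hd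
    rw [run_cons, g.apply_translate fun q hq => hd q (.inl hq), ih fun q hq => hd q (.inr hq),
      run_cons]

lemma run_ket_add (C : Circuit m) {d : Bits m} (hd : ∀ q ∈ C.touched, d q = 0) (u w : Bits m) :
    run C (ket (u + d)) (w + d) = run C (ket u) w := by
  have h := congrFun (C.run_translate hd (ket (u + d))) w
  simp only [ket, add_left_inj] at h
  exact h.symm

/-- A circuit preserves the qubits in `A` if every basis state is mapped to a superposition of
basis states with the same values at these qubits. -/
def Preserves (C : Circuit m) (A : Set (Fin m)) : Prop :=
  ∀ ⦃u w : Bits m⦄, run C (ket u) w ≠ 0 → Set.EqOn u w A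

lemma Preserves.mono {C : Circuit m} {A A' : Set (Fin m)} (h : C.Preserves A) (hA : A' ⊆ A) :
    C.Preserves A' :=
  fun _ _ hw => (h hw).mono hA

lemma Preserves.append {C D : Circuit m} {A : Set (Fin m)} (hC : C.Preserves A)
    (hD : D.Preserves A) : (C ++ D).Preserves A := by
  intro u w hw
  rw [run_append] at hw
  obtain ⟨v, hv, hvw⟩ := exists_run_ket_ne_zero hw
  exact (hC hv).trans (hD hvw)

lemma Preserves.inv {C : Circuit m} {A : Set (Fin m)} (h : C.Preserves A) : C.inv.Preserves A := by
  intro u w hw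
  rw [run_inv_ket_apply, star_ne_zero] at hw
  exact (h hw).symm

lemma preserves_compl_touched (C : Circuit m) : C.Preserves (C.touched : Set (Fin m))ᶜ := by
  induction C with
  | nil =>
    intro u w hw q _
    have : w = u := by by_contra h; exact hw (by simp [run_nil, ket, h])
    rw [this]
  | cons g C ih =>
    intro u w hw q hq
    obtain ⟨v, hv, hvw⟩ := exists_run_ket_ne_zero (run_cons g C _ ▸ hw)
    simp only [touched_cons, Finset.coe_union, Set.compl_union] at hq
    exact (g.eqOn_of_apply_ket_ne_zero hv hq.1).trans (ih hvw hq.2)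

/-- The same circuit on a larger system, in which the `i`-th qubit has the number `e i`. -/
def relabel {M : ℕ} (e : Fin m ↪ Fin M) (C : Circuit m) : Circuit M := C.map (Gate.relabel e)

lemma length_relabel {M : ℕ} (e : Fin m ↪ Fin M) (C : Circuit m) :
    (C.relabel e).length = C.length := by
  simp [relabel]

lemma touched_relabel {M : ℕ} (e : Fin m ↪ Fin M) (C : Circuit m) :
    (C.relabel e).touched = C.touched.map e := by
  induction C with
  | nil => rfl
  | cons g C ih =>
    rw [touched_cons, Finset.map_union, ← ih, ← g.touched_relabel]
    rfl

lemma run_relabel {M : ℕ} (e : Fin m ↪ Fin M) (C : Circuit m) (ψ : QState M) (w : Bits M) :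
    run (C.relabel e) ψ w = run C (fun u => ψ (Function.extend e u w)) (w ∘ e) := by
  induction C generalizing ψ with
  | nil => simp only [relabel, List.map_nil, run_nil, extend_comp_self]
  | cons g C ih =>
    have extend_comp (u : Bits m) : Function.extend e u w ∘ e = u :=
      Function.extend_comp e.injective u w
    rw [relabel, List.map_cons, run_cons, run_cons, ← relabel, ih]
    simp only [Gate.apply_relabel, extend_extend, extend_comp]

lemma run_relabel_ket_extend {M : ℕ} (e : Fin m ↪ Fin M) (C : Circuit m) (u : Bits m)
    (w : Bits M) :
    run (C.relabel e) (ket (Function.extend e u w)) =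
      ∑ v, run C (ket u) v • ket (Function.extend e v w) := by
  have extend_inj {v v' : Bits m} : Function.extend e v w = Function.extend e v' w ↔ v = v' :=
    (Function.extend_injective e.injective w).eq_iff
  ext w'
  rw [run_relabel]
  by_cases hw' : ∃ v, w' = Function.extend e v w
  · obtain ⟨v, rfl⟩ := hw'
    have ket_extend : (fun v' => ket (Function.extend e u w)
        (Function.extend e v' (Function.extend e v w))) = ket u := by
      simp only [ket, extend_extend, extend_inj]
      rfl
    rw [ket_extend, Function.extend_comp e.injective]
    simp [ket, extend_inj]
  · push Not at hw'
    have h0 (v : Bits m) : Function.extend e v w' ≠ Function.extend e u w := fun h =>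
      hw' (w' ∘ e) (by rw [← extend_extend e (w' ∘ e) u w, ← h, extend_extend, extend_comp_self])
    have zero_eq : (fun v => ket (Function.extend e u w) (Function.extend e v w')) = 0 := by
      simp only [ket, h0, if_false]
      rfl
    rw [zero_eq, C.isLinearMap_run.map_zero]
    simp [ket, hw']

lemma exists_of_run_relabel_ket_ne_zero {M : ℕ} {e : Fin m ↪ Fin M} {C : Circuit m} {u w : Bits M}
    (h : run (C.relabel e) (ket u) w ≠ 0) :
    ∃ v, run C (ket (u ∘ e)) v ≠ 0 ∧ w = Function.extend e v u := by
  rw [← extend_comp_self e u, run_relabel_ket_extend, Finset.sum_apply] at h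
  obtain ⟨v, -, hv⟩ := Finset.exists_ne_zero_of_sum_ne_zero h
  refine ⟨v, left_ne_zero_of_mul hv, ?_⟩
  by_contra hne
  exact hv (by simp [ket, hne])

end Circuit

/-- Born's rule: the probability that measuring all qubits of the state `ψ` yields a string with
the property `P`. -/
noncomputable def prob (ψ : QState m) (P : Bits m → Prop) [DecidablePred P] : ℝ :=
  ∑ w with P w, ‖ψ w‖ ^ 2

lemma prob_nonneg (ψ : QState m) (P : Bits m → Prop) [DecidablePred P] : 0 ≤ prob ψ P :=
  Finset.sum_nonneg fun _ _ => sq_nonneg _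

lemma sq_norm_le_prob (ψ : QState m) {P : Bits m → Prop} [DecidablePred P] {w : Bits m}
    (hw : P w) : ‖ψ w‖ ^ 2 ≤ prob ψ P :=
  Finset.single_le_sum (f := fun w => ‖ψ w‖ ^ 2) (fun _ _ => sq_nonneg _) (by simpa using hw)

lemma prob_mono (ψ : QState m) {P Q : Bits m → Prop} [DecidablePred P] [DecidablePred Q]
    (h : ∀ w, P w → Q w) : prob ψ P ≤ prob ψ Q :=
  Finset.sum_le_sum_of_subset_of_nonneg
    (fun w hw => by simpa using h w (by simpa using hw)) fun _ _ _ => sq_nonneg _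

namespace Circuit

lemma prob_run_ket_true (C : Circuit m) (s : Bits m) :
    prob (run C (ket s)) (fun _ => True) = 1 := by
  simp only [prob, Finset.filter_true, sum_sq_norm_run]
  simp [ket, apply_ite norm, ite_pow]

lemma prob_run_ket_le_one (C : Circuit m) (s : Bits m) (P : Bits m → Prop) [DecidablePred P] :
    prob (run C (ket s)) P ≤ 1 :=
  (prob_mono _ fun _ _ => trivial).trans_eq (C.prob_run_ket_true s)

lemma prob_not_run_ket (C : Circuit m) (s : Bits m) (P : Bits m → Prop) [DecidablePred P] :
    prob (run C (ket s)) (fun w => ¬P w) = 1 - prob (run C (ket s)) P := by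
  rw [eq_sub_iff_add_eq', ← prob_run_ket_true C s]
  simp only [prob, Finset.filter_true]
  exact Finset.sum_filter_add_sum_filter_not _ _ _

variable {n k : ℕ}

lemma outProb_eq_prob (C : Circuit m) (hn : n ≤ m) (hk : k ≤ m) (x : Bits n) (z : Bits k) :
    C.outProb hn hk x z =
      prob (run C (ket (padZero m x))) fun w => ∀ i, w (Fin.castLE hk i) = z i :=
  (Finset.sum_filter _ _).symm

lemma outProb_nonneg (C : Circuit m) (hn : n ≤ m) (hk : k ≤ m) (x : Bits n) (z : Bits k) :
    0 ≤ C.outProb hn hk x z :=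
  outProb_eq_prob C hn hk x z ▸ prob_nonneg _ _

end Circuit

end Circuits

/-! ### Elementary circuits -/

section Elementary

variable {m : ℕ}

lemma permMatrix_mem_unitaryGroup {α : Type*} [Fintype α] [DecidableEq α] (σ : Equiv.Perm α) :
    σ.permMatrix ℂ ∈ unitaryGroup α ℂ := by
  rw [mem_unitaryGroup_iff, star_eq_conjTranspose, conjTranspose_permMatrix, ← permMatrix_mul,
    inv_mul_cancel, permMatrix_one]

lemma diagonal_mem_unitaryGroup {α : Type*} [Fintype α] [DecidableEq α] {d : α → ℂ}
    (hd : ∀ a, d a * star (d a) = 1) : diagonal d ∈ unitaryGroup α ℂ := by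
  rw [mem_unitaryGroup_iff, star_eq_conjTranspose, diagonal_conjTranspose, diagonal_mul_diagonal]
  exact (congrArg diagonal (funext hd)).trans diagonal_one

/-- The number `1/√2`. -/
noncomputable def invSqrtTwo : ℂ := ((√2)⁻¹ : ℝ)

lemma invSqrtTwo_sq : invSqrtTwo ^ 2 = 1 / 2 := by
  rw [invSqrtTwo, ← Complex.ofReal_pow, inv_pow, Real.sq_sqrt zero_le_two]
  norm_num

lemma star_invSqrtTwo : star invSqrtTwo = invSqrtTwo := Complex.conj_ofReal _

/-- The Hadamard matrix. -/
noncomputable def hadamardMatrix : Matrix (ZMod 2) (ZMod 2) ℂ :=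
  of fun a b => invSqrtTwo * sgn (a * b)

lemma hadamardMatrix_apply (a b : ZMod 2) : hadamardMatrix a b = invSqrtTwo * sgn (a * b) := rfl

lemma star_hadamardMatrix : star hadamardMatrix = hadamardMatrix := by
  ext a b
  rw [star_apply, hadamardMatrix_apply, star_mul', star_invSqrtTwo, star_sgn, mul_comm b,
    hadamardMatrix_apply]

lemma hadamardMatrix_mem_unitaryGroup : hadamardMatrix ∈ unitaryGroup (ZMod 2) ℂ := by
  rw [mem_unitaryGroup_iff, star_hadamardMatrix]
  have sum_sgn_mul_sgn (a b : ZMod 2) :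
      ∑ c, sgn (a * c) * sgn (c * b) = if a = b then 2 else 0 := by
    rw [sum_zmod_two]
    rcases zmod_two_cases a with rfl | rfl <;> rcases zmod_two_cases b with rfl | rfl <;>
      simp [sgn_one, one_add_one_eq_two]
  ext a b
  calc (hadamardMatrix * hadamardMatrix) a b
      = invSqrtTwo ^ 2 * ∑ c, sgn (a * c) * sgn (c * b) := by
        simp only [mul_apply, hadamardMatrix_apply, Finset.mul_sum]
        exact Finset.sum_congr rfl fun _ _ => by ring
    _ = (1 : Matrix (ZMod 2) (ZMod 2) ℂ) a b := by
        rw [sum_sgn_mul_sgn, invSqrtTwo_sq, one_apply]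
        split_ifs <;> norm_num

namespace Gate

/-- The Hadamard gate. -/
noncomputable def had (i : Fin m) : Gate m := .one i ⟨_, hadamardMatrix_mem_unitaryGroup⟩

/-- The Pauli gate `X`, which negates a bit. -/
noncomputable def pauliX (i : Fin m) : Gate m :=
  .one i ⟨_, permMatrix_mem_unitaryGroup (Equiv.addRight 1)⟩

/-- The Pauli gate `Z`, which introduces the sign of a bit. -/
noncomputable def pauliZ (i : Fin m) : Gate m :=
  .one i ⟨_, diagonal_mem_unitaryGroup (d := sgn) fun a => by rw [star_sgn, sgn_mul_self]⟩

lemma apply_had_ket (i : Fin m) (u : Bits m) :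
    (had i).apply (ket u) =
      ∑ c, (invSqrtTwo * sgn (u i * c)) • ket (Function.update u i c) := by
  simp only [had, apply_one_eq_act, ket_eq_single, Register.act_single, hadamardMatrix_apply,
    Register.coord, mul_comm (u i)]

lemma apply_pauliX_ket (i : Fin m) (u : Bits m) :
    (pauliX i).apply (ket u) = ket (u + Pi.single i 1) := by
  simp only [pauliX, apply_one_eq_act, ket_eq_single, Register.act_permMatrix_single]
  congr 1
  ext q
  rcases eq_or_ne q i with rfl | hq <;> simp [Register.coord, *]

lemma apply_pauliZ_ket (i : Fin m) (u : Bits m) :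
    (pauliZ i).apply (ket u) = sgn (u i) • ket u := by
  simp only [pauliZ, apply_one_eq_act, ket_eq_single, Register.act_diagonal_single]
  rfl

lemma inv_had (i : Fin m) : (had i).inv = had i :=
  congrArg (Gate.one i) (Subtype.ext star_hadamardMatrix)

lemma apply_had_apply_had (i : Fin m) (ψ : QState m) : (had i).apply ((had i).apply ψ) = ψ := by
  simpa only [inv_had] using (had i).apply_inv_apply ψ

end Gate

lemma prob_apply_had {q : Fin m} {ψ : QState m} (hψ : ∀ w, ψ w ≠ 0 → w q = 0)
    (P : Bits m → Prop) [DecidablePred P] :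
    prob ((Gate.had q).apply ψ) (fun w => w q = 0 ∧ P w) = prob ψ P / 2 := by
  have apply_eq_zero {w : Bits m} (hw : w q ≠ 0) : ψ w = 0 := by
    contrapose! hw
    exact hψ w hw
  have had_apply {w : Bits m} (hw : w q = 0) : (Gate.had q).apply ψ w = invSqrtTwo * ψ w := by
    have update_zero : Function.update w q 0 = w := by rw [← hw, Function.update_eq_self]
    have : ψ (Function.update w q 1) = 0 := apply_eq_zero (by simp)
    simp [Gate.had, Gate.apply, sum_zmod_two, hadamardMatrix_apply, hw, update_zero, this]
  have sq_norm_had {w : Bits m} (hw : w q = 0) :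
      ‖(Gate.had q).apply ψ w‖ ^ 2 = ‖ψ w‖ ^ 2 / 2 := by
    rw [had_apply hw, norm_mul, mul_pow, ← norm_pow invSqrtTwo, invSqrtTwo_sq]
    norm_num
    ring
  simp only [prob, Finset.sum_div]
  rw [Finset.sum_congr rfl fun w hw => sq_norm_had (Finset.mem_filter.1 hw).2.1]
  refine Finset.sum_subset (Finset.monotone_filter_right _ fun w _ hw => hw.2) fun w hw hw' => ?_
  have hPw := (Finset.mem_filter.1 hw).2
  rw [apply_eq_zero fun hq => hw' (by simp [hq, hPw])]
  simp

namespace Circuit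

open Gate

/-- The circuit consisting of one two-qubit gate, empty if the two qubits are equal. -/
def two (i j : Fin m) (U : unitaryGroup (ZMod 2 × ZMod 2) ℂ) : Circuit m :=
  if h : i ≠ j then [.two i j h U] else []

lemma length_two_le (i j : Fin m) (U : unitaryGroup (ZMod 2 × ZMod 2) ℂ) :
    (two i j U).length ≤ 1 := by
  unfold two
  split_ifs <;> simp

lemma run_two {i j : Fin m} (hij : i ≠ j) (U : unitaryGroup (ZMod 2 × ZMod 2) ℂ) (ψ : QState m) :
    run (two i j U) ψ = (Register.pair i j hij).act U ψ := by
  rw [two, dif_pos hij, run_cons, run_nil, apply_two_eq_act]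

/-- The permutation `(x, y) ↦ (x, y + x)`. -/
def shear : Equiv.Perm (ZMod 2 × ZMod 2) :=
  Function.Involutive.toPerm (fun p => (p.1, p.2 + p.1)) fun p => by
    simp [add_assoc, CharTwo.add_self_eq_zero]

lemma shear_symm_apply (p : ZMod 2 × ZMod 2) : shear.symm p = (p.1, p.2 + p.1) := rfl

/-- The controlled-not gate with control `a` and target `t`. -/
noncomputable def cnot (a t : Fin m) : Circuit m := two a t ⟨_, permMatrix_mem_unitaryGroup shear⟩

lemma run_cnot_ket {a t : Fin m} (h : a ≠ t) (u : Bits m) :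
    run (cnot a t) (ket u) = ket (u + Pi.single t (u a)) := by
  simp only [cnot, run_two h, ket_eq_single, Register.act_permMatrix_single, shear_symm_apply]
  congr 1
  ext q
  rcases eq_or_ne q t with rfl | hq <;> simp [Register.pair, *]

/-- The phase `z^(xy)` of a pair of bits `(x, y)`. -/
noncomputable def phase (z : ℂ) (p : ZMod 2 × ZMod 2) : ℂ := if p = (1, 1) then z else 1

/-- The controlled phase gate. -/
noncomputable def cphase (z : unitary ℂ) (a t : Fin m) : Circuit m :=
  two a t ⟨_, diagonal_mem_unitaryGroup (d := phase z) fun p => by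
    unfold phase
    split_ifs
    exacts [Unitary.coe_mul_star_self z, by simp]⟩

lemma run_cphase_ket (z : unitary ℂ) {a t : Fin m} (h : a ≠ t) (u : Bits m) :
    run (cphase z a t) (ket u) = phase z (u a, u t) • ket u := by
  simp only [cphase, run_two h, ket_eq_single, Register.act_diagonal_single]
  rfl

/-- The number `i` as an element of the unit circle. -/
def unitI : unitary ℂ := ⟨Complex.I, by simp [Unitary.mem_iff]⟩

/-- Controlled-not gates from `a i` to `t i` for all `i` in a set. -/
noncomputable def cnots {α : Type*} (a t : α → Fin m) (S : Finset α) : Circuit m :=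
  S.toList.flatMap fun i => cnot (a i) (t i)

lemma length_cnots_le {α : Type*} (a t : α → Fin m) (S : Finset α) :
    (cnots a t S).length ≤ S.card := by
  rw [cnots, List.length_flatMap, ← Finset.length_toList S, ← mul_one (List.length _)]
  refine (List.sum_le_card_nsmul _ 1 ?_).trans_eq (by simp)
  simp only [List.mem_map, forall_exists_index, and_imp, forall_apply_eq_imp_iff₂]
  exact fun i _ => length_two_le _ _ _

lemma run_cnots_ket {α : Type*} {a t : α → Fin m} (h : ∀ i j, a i ≠ t j) (S : Finset α)
    (u : Bits m) :
    run (cnots a t S) (ket u) = ket (u + ∑ i ∈ S, Pi.single (t i) (u (a i))) := by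
  rw [← Finset.sum_map_toList S, cnots]
  induction S.toList generalizing u with
  | nil => simp [run_nil]
  | cons i L ih =>
    rw [List.flatMap_cons, run_append, run_cnot_ket (h i i), ih, List.map_cons, List.sum_cons,
      add_assoc]
    simp [h]

/-- A circuit that introduces the sign `(-1)^(x(1+y)z)` of the bits `x, y, z` at `a, b, t`. -/
noncomputable def sgnMul (a b t : Fin m) : Circuit m :=
  cphase unitI⁻¹ b t ++ cnot a b ++ cphase unitI b t ++ cnot a b ++ cphase unitI a t

lemma length_sgnMul_le (a b t : Fin m) : (sgnMul a b t).length ≤ 5 := by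
  simp only [sgnMul, List.length_append]
  have (z : unitary ℂ) (i j : Fin m) : (cphase z i j).length ≤ 1 := length_two_le _ _ _
  have cnot_le : (cnot a b).length ≤ 1 := length_two_le _ _ _
  linarith [this unitI⁻¹ b t, this unitI b t, this unitI a t]

-- `2x(1 - y) = x - y + (x ⊕ y)` for `x, y ∈ {0, 1}`
lemma phase_mul_phase_mul_phase (x y z : ZMod 2) :
    phase (unitI⁻¹ : unitary ℂ) (y, z) * phase unitI (y + x, z) * phase unitI (x, z) =
      sgn (x * (y + 1) * z) := by
  rcases zmod_two_cases x with rfl | rfl <;> rcases zmod_two_cases y with rfl | rfl <;>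
    rcases zmod_two_cases z with rfl | rfl <;>
    simp [phase, unitI, sgn_one, CharTwo.add_self_eq_zero, ← Unitary.star_eq_inv]

lemma run_sgnMul_ket {a b t : Fin m} (hab : a ≠ b) (hat : a ≠ t) (hbt : b ≠ t) (u : Bits m) :
    run (sgnMul a b t) (ket u) = sgn (u a * (u b + 1) * u t) • ket u := by
  have add_add : (u + Pi.single b (u a) + Pi.single b (u a) : Bits m) = u := by
    rw [add_assoc, ZModModule.add_self, add_zero]
  have add_apply : (u + Pi.single b (u a) : Bits m) a = u a := by simp [hab]
  simp only [sgnMul, run_append, run_smul, run_cphase_ket _ hat, run_cphase_ket _ hbt,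
    run_cnot_ket hab, add_apply, add_add, smul_smul, ← phase_mul_phase_mul_phase]
  simp [hbt.symm, mul_comm]

/-- The gate that negates the bit at `t` if the bit at `a` is one and the bit at `b` is zero. -/
noncomputable def toffoli (a b t : Fin m) : Circuit m := had t :: (sgnMul a b t ++ [had t])

lemma length_toffoli_le (a b t : Fin m) : (toffoli a b t).length ≤ 7 := by
  simp only [toffoli, List.length_cons, List.length_append, List.length_nil]
  linarith [length_sgnMul_le a b t]

lemma run_toffoli_ket {a b t : Fin m} (hab : a ≠ b) (hat : a ≠ t) (hbt : b ≠ t) (u : Bits m) :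
    run (toffoli a b t) (ket u) = ket (u + Pi.single t (u a * (u b + 1))) := by
  have run_sgnMul_had : run (sgnMul a b t) ((had t).apply (ket u)) =
      (had t).apply (ket (u + Pi.single t (u a * (u b + 1)))) := by
    simp only [apply_had_ket, run_sum, run_smul, run_sgnMul_ket hab hat hbt, smul_smul]
    refine Finset.sum_congr rfl fun c _ => ?_
    have update_eq : Function.update (u + Pi.single t (u a * (u b + 1))) t c =
        Function.update u t c := by
      ext q
      rcases eq_or_ne q t with rfl | hq <;> simp [*]
    rw [update_eq, mul_assoc, ← AddChar.map_add_eq_mul]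
    simp [hat, hbt, add_mul]
  rw [toffoli, run_cons, run_append, run_sgnMul_had, run_cons, run_nil, apply_had_apply_had]

end Circuit

end Elementary

section MultipleControl

variable {m : ℕ}

namespace Circuit

open Gate

/-- The circuit `D` conjugated by the circuit `C`. -/
def conj (C D : Circuit m) : Circuit m := C ++ D ++ C.inv

lemma length_conj (C D : Circuit m) : (conj C D).length = 2 * C.length + D.length := by
  simp only [conj, List.length_append, length_inv]
  ring

lemma run_conj (C D : Circuit m) (ψ : QState m) :
    run (conj C D) ψ = run C.inv (run D (run C ψ)) := by
  simp only [conj, run_append]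

lemma Preserves.conj {C D : Circuit m} {A : Set (Fin m)} (hC : C.Preserves A)
    (hD : D.Preserves A) : (conj C D).Preserves A :=
  (hC.append hD).append hC.inv

lemma run_conj_ket {C D : Circuit m} {u : Bits m} {a : ℂ}
    (h : ∀ v, run C (ket u) v ≠ 0 → run D (ket v) = a • ket v) :
    run (conj C D) (ket u) = a • ket u := by
  have run_D : run D (run C (ket u)) = a • run C (ket u) := run_eq_mul_of_ket h
  rw [run_conj, run_D, run_smul, run_inv_run]

lemma eq_of_ket_ne_zero {u v : Bits m} (h : ket u v ≠ 0) : v = u := by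
  by_contra hne
  exact h (if_neg hne)

variable {D : Type*} (e : D ⊕ D ↪ Fin m)

/-- A circuit that introduces the sign `-1` if the bit at `c` is one and all bits in a list are
zero. It uses the qubit `e (.inr q)` as auxiliary qubit for the qubit `e (.inl q)`. -/
noncomputable def ladder : D ⊕ D → List D → Circuit m
  | c, [] => [pauliZ (e c)]
  | c, q :: L => conj (toffoli (e c) (e (.inl q)) (e (.inr q))) (ladder (.inr q) L)

lemma length_ladder_le (c : D ⊕ D) (L : List D) : (ladder e c L).length ≤ 14 * L.length + 1 := by
  induction L generalizing c with
  | nil => simp [ladder]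
  | cons q L ih =>
    rw [ladder, length_conj, List.length_cons]
    linarith [length_toffoli_le (e c) (e (.inl q)) (e (.inr q)), ih (.inr q)]

variable {e}

lemma run_ladder_ket {c : D ⊕ D} {L : List D} (hL : L.Nodup) (hc : ∀ q ∈ L, c ≠ .inl q ∧ c ≠ .inr q)
    {u : Bits m} (hu : ∀ q ∈ L, u (e (.inr q)) = 0) :
    run (ladder e c L) (ket u) =
      sgn (u (e c) * (L.map fun q => u (e (.inl q)) + 1).prod) • ket u := by
  induction L generalizing c u with
  | nil => rw [ladder, run_cons, run_nil, apply_pauliZ_ket, List.map_nil, List.prod_nil, mul_one]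
  | cons q L ih =>
    obtain ⟨hcl, hcr⟩ := hc q List.mem_cons_self
    obtain ⟨hq, hL⟩ := List.nodup_cons.1 hL
    have ne_of_mem {q' : D} (h : q' ∈ L) : q ≠ q' := fun h' => hq (h' ▸ h)
    refine run_conj_ket fun v hv => ?_
    rw [run_toffoli_ket (e.injective.ne hcl) (e.injective.ne hcr) (e.injective.ne (by simp))] at hv
    obtain rfl := eq_of_ket_ne_zero hv
    rw [ih hL (fun q' h => by simp [ne_of_mem h]) fun q' h => by
      simp [(ne_of_mem h).symm, hu q' (List.mem_cons_of_mem q h)]]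
    simp [hu q List.mem_cons_self, mul_assoc]

/-- A circuit that introduces the sign `-1` if all bits in `insert c S` are zero. -/
noncomputable def zeroSign (e : D ⊕ D ↪ Fin m) (c : D) (S : Finset D) : Circuit m :=
  conj [pauliX (e (.inl c))] (ladder e (.inl c) S.toList)

lemma length_zeroSign_le (c : D) (S : Finset D) :
    (zeroSign e c S).length ≤ 14 * S.card + 3 := by
  rw [zeroSign, length_conj, List.length_singleton, ← S.length_toList]
  linarith [length_ladder_le e (.inl c) S.toList]

lemma sgn_prod_add_one {α : Type*} (S : Finset α) (p : α → ZMod 2) :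
    sgn (∏ q ∈ S, (p q + 1)) = if ∀ q ∈ S, p q = 0 then -1 else 1 := by
  split_ifs with h
  · rw [Finset.prod_eq_one fun q hq => by rw [h q hq, zero_add], sgn_one]
  · push Not at h
    obtain ⟨q, hq, hpq⟩ := h
    have : p q + 1 = 0 := by
      rw [(zmod_two_cases (p q)).resolve_left hpq, CharTwo.add_self_eq_zero]
    rw [Finset.prod_eq_zero hq this, AddChar.map_zero_eq_one]

lemma run_zeroSign_ket [DecidableEq D] {c : D} {S : Finset D} (hc : c ∉ S) {u : Bits m}
    (hu : ∀ q ∈ S, u (e (.inr q)) = 0) :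
    run (zeroSign e c S) (ket u) =
      (if ∀ q ∈ insert c S, u (e (.inl q)) = 0 then -1 else 1 : ℂ) • ket u := by
  refine run_conj_ket fun v hv => ?_
  rw [run_cons, run_nil, apply_pauliX_ket] at hv
  obtain rfl := eq_of_ket_ne_zero hv
  have ne_of_mem {q : D} (h : q ∈ S) : q ≠ c := fun h' => hc (h' ▸ h)
  rw [run_ladder_ket S.nodup_toList
    (fun q h => by simp [(ne_of_mem (Finset.mem_toList.1 h)).symm])
    fun q h => by simp [hu q (Finset.mem_toList.1 h)], Finset.prod_map_toList,
    ← sgn_prod_add_one, Finset.prod_insert hc]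
  congr 3
  · simp
  · exact Finset.prod_congr rfl fun q h => by simp [ne_of_mem h]

end Circuit

end MultipleControl

section HadamardLayer

variable {m : ℕ}

namespace Circuit

open Gate

/-- Hadamard gates on all qubits in a set. -/
noncomputable def hads (S : Finset (Fin m)) : Circuit m := S.toList.map had

lemma length_hads (S : Finset (Fin m)) : (hads S).length = S.card := by simp [hads]

lemma touched_hads (S : Finset (Fin m)) : (hads S).touched = S := by
  have touched_map_had (L : List (Fin m)) : touched (L.map had) = L.toFinset := by
    induction L with
    | nil => rfl
    | cons i L ih => rw [List.map_cons, touched_cons, ih, List.toFinset_cons]; rfl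
  rw [hads, touched_map_had, Finset.toList_toFinset]

lemma run_map_had_ket_apply {L : List (Fin m)} (hL : L.Nodup) (u w : Bits m) :
    run (L.map had) (ket u) w =
      if ∀ q ∉ L, w q = u q then invSqrtTwo ^ L.length * sgn (L.map fun q => w q * u q).sum
      else 0 := by
  induction L generalizing u with
  | nil => simp [run_nil, ket, funext_iff]
  | cons i L ih =>
    obtain ⟨hi, hL⟩ := List.nodup_cons.1 hL
    have map_update (c : ZMod 2) :
        (L.map fun q => w q * Function.update u i c q) = L.map fun q => w q * u q :=
      List.map_congr_left fun q hq => by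
        rw [Function.update_of_ne (ne_of_mem_of_not_mem hq hi)]
    have forall_iff (c : ZMod 2) : (∀ q ∉ L, w q = Function.update u i c q) ↔
        c = w i ∧ ∀ q ∉ i :: L, w q = u q := by
      constructor
      · intro h
        refine ⟨by simpa using (h i hi).symm, fun q hq => ?_⟩
        rw [List.mem_cons, not_or] at hq
        simpa [hq.1] using h q hq.2
      · rintro ⟨rfl, h⟩ q hq
        rcases eq_or_ne q i with rfl | hqi
        · simp
        · simpa [hqi] using h q (by simp [hqi, hq])
    rw [List.map_cons, run_cons, apply_had_ket, run_sum]
    simp only [run_smul, Finset.sum_apply, Pi.smul_apply, ih hL, map_update, forall_iff, ite_and]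
    simp only [smul_ite, smul_zero, Finset.sum_ite_eq', Finset.mem_univ, if_true]
    refine if_congr Iff.rfl ?_ rfl
    rw [List.length_cons, List.map_cons, List.sum_cons, AddChar.map_add_eq_mul, smul_eq_mul,
      mul_comm (u i)]
    ring

lemma run_hads_ket_apply (S : Finset (Fin m)) (u w : Bits m) :
    run (hads S) (ket u) w =
      if ∀ q ∉ S, w q = u q then invSqrtTwo ^ S.card * sgn (∑ q ∈ S, w q * u q) else 0 := by
  simp [hads, run_map_had_ket_apply S.nodup_toList]

end Circuit

end HadamardLayer

/-! ### Averaging over the number of iterations -/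

section Averaging

open Real

lemma two_mul_cos_sub_cos_mul_sum (γ φ : ℝ) (N : ℕ) :
    2 * (cos φ - cos γ) * ∑ k ∈ Finset.range N, sin ((k + 1) * γ) * cos ((k + 1) * φ) =
      sin (N * γ) * cos ((N + 1) * φ) - sin ((N + 1) * γ) * cos (N * φ) + sin γ := by
  induction N with
  | zero => simp
  | succ N ih =>
    have add_one_mul_add (x : ℝ) : (N + 1 + 1 : ℝ) * x = (N + 1) * x + x := by ring
    have mul_sub_self (x : ℝ) : (N : ℝ) * x = (N + 1) * x - x := by ring
    rw [Finset.sum_range_succ, mul_add, ih]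
    push_cast
    rw [add_one_mul_add, add_one_mul_add, mul_sub_self, mul_sub_self, cos_add, cos_sub, sin_add,
      sin_sub]
    ring

/-- Positive weights on the numbers `0, …, N - 1`: the entries of the Perron eigenvector of a path
with `N` vertices. -/
noncomputable def weight (N k : ℕ) : ℝ := sin ((k + 1) * (π / (N + 1)))

lemma weight_pos {N k : ℕ} (hk : k < N) : 0 < weight N k := by
  have hk' : (k + 1 : ℝ) < N + 1 := by exact_mod_cast Nat.succ_lt_succ hk
  refine sin_pos_of_pos_of_lt_pi (by positivity) ?_
  rw [← mul_div_assoc, div_lt_iff₀ (by positivity), mul_comm π]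
  exact mul_lt_mul_of_pos_right hk' pi_pos

lemma sum_weight_mul_cos_nonpos {N : ℕ} {φ : ℝ} (hN : π / (N + 1) < φ) (hφ : φ ≤ π) :
    ∑ k ∈ Finset.range N, weight N k * cos ((k + 1) * φ) ≤ 0 := by
  unfold weight
  set γ := π / (N + 1) with hγ
  have hγ_pos : 0 < γ := by positivity
  have add_one_mul : (N + 1 : ℝ) * γ = π := by rw [hγ]; field_simp
  have closed_form := two_mul_cos_sub_cos_mul_sum γ φ N
  rw [show N * γ = π - γ by rw [← add_one_mul]; ring, add_one_mul, sin_pi,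
    sin_pi_sub] at closed_form
  have cos_lt : cos φ < cos γ := cos_lt_cos_of_nonneg_of_le_pi hγ_pos.le hφ hN
  have sin_nonneg : 0 ≤ sin γ := sin_nonneg_of_nonneg_of_le_pi hγ_pos.le (hN.le.trans hφ)
  by_contra! h
  nlinarith [mul_nonneg sin_nonneg (neg_le_iff_add_nonneg.1 (neg_one_le_cos ((N + 1) * φ))),
    mul_pos (sub_pos.2 cos_lt) h]

lemma sin_sq_add_sin_sq (θ : ℝ) (k : ℕ) :
    sin ((2 * (k + 1 : ℕ) + 1) * θ) ^ 2 + sin ((2 * k + 1) * θ) ^ 2 =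
      1 - cos (2 * θ) * cos ((k + 1) * (4 * θ)) := by
  have upper : 2 * ((2 * (k + 1 : ℕ) + 1) * θ) = (k + 1) * (4 * θ) + 2 * θ := by push_cast; ring
  have lower : 2 * ((2 * k + 1) * θ) = (k + 1) * (4 * θ) - 2 * θ := by ring
  rw [sin_sq_eq_half_sub, sin_sq_eq_half_sub, upper, lower, cos_add, cos_sub]
  ring

lemma sum_weight_le_sum_weight_mul {N : ℕ} {θ : ℝ} (hN : π / (N + 1) < 4 * θ) (hθ : θ ≤ π / 4) :
    ∑ k ∈ Finset.range N, weight N k ≤ ∑ k ∈ Finset.range N, weight N k *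
      (sin ((2 * (k + 1 : ℕ) + 1) * θ) ^ 2 + sin ((2 * k + 1) * θ) ^ 2) := by
  have θ_pos : 0 < 4 * θ := lt_of_le_of_lt (by positivity) hN
  have cos_nonneg : 0 ≤ cos (2 * θ) :=
    cos_nonneg_of_mem_Icc ⟨by linarith [pi_pos], by linarith⟩
  have sum_nonpos := sum_weight_mul_cos_nonpos hN (by linarith)
  calc ∑ k ∈ Finset.range N, weight N k
      ≤ ∑ k ∈ Finset.range N, weight N k -
          cos (2 * θ) * ∑ k ∈ Finset.range N, weight N k * cos ((k + 1) * (4 * θ)) := by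
        linarith [mul_nonpos_of_nonneg_of_nonpos cos_nonneg sum_nonpos]
    _ = _ := by
        rw [Finset.mul_sum, ← Finset.sum_sub_distrib]
        refine Finset.sum_congr rfl fun k _ => ?_
        rw [sin_sq_add_sin_sq]
        ring

lemma exists_card_div_two_le_sum_sin_sq {Y : Type*} (S : Finset Y) (θ : Y → ℝ) {N : ℕ}
    (hN : 1 ≤ N) (hθN : ∀ y ∈ S, π / (N + 1) < 4 * θ y) (hθ : ∀ y ∈ S, θ y ≤ π / 4) :
    ∃ j ≤ N, (S.card : ℝ) / 2 ≤ ∑ y ∈ S, sin ((2 * j + 1) * θ y) ^ 2 := by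
  set p : ℕ → ℝ := fun j => ∑ y ∈ S, sin ((2 * j + 1) * θ y) ^ 2
  have sum_le : (S.card : ℝ) * ∑ k ∈ Finset.range N, weight N k ≤
      ∑ k ∈ Finset.range N, weight N k * (p (k + 1) + p k) := by
    simp only [p, ← Finset.sum_add_distrib, Finset.mul_sum]
    rw [Finset.sum_comm, ← Finset.mul_sum, ← nsmul_eq_mul, ← Finset.sum_const]
    exact Finset.sum_le_sum fun y hy => sum_weight_le_sum_weight_mul (hθN y hy) (hθ y hy)
  by_contra! h
  refine sum_le.not_gt ?_
  rw [mul_comm, Finset.sum_mul]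
  refine Finset.sum_lt_sum_of_nonempty ⟨0, Finset.mem_range.2 hN⟩ fun k hk => ?_
  have hk := Finset.mem_range.1 hk
  exact mul_lt_mul_of_pos_left (by linarith [h (k + 1) hk, h k hk.le]) (weight_pos hk)

lemma exists_sin_sq_eq {p ε : ℝ} (hε : 0 < ε) (hp : 2 * ε ^ 2 ≤ p) (hp' : p ≤ 1 / 2) :
    ∃ θ : ℝ, π * ε < 4 * θ ∧ θ ≤ π / 4 ∧ sin θ ^ 2 = p := by
  have sqrt_le : √p ≤ √2 / 2 := by
    rw [Real.sqrt_le_left (by positivity), div_pow, Real.sq_sqrt zero_le_two]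
    linarith
  have le_sqrt : 7 / 5 * ε ≤ √p := le_sqrt_of_sq_le (by nlinarith)
  have sqrt_two_lt : √2 < 2 := (sqrt_lt' two_pos).2 (by norm_num)
  have sqrt_pos : 0 < √p := lt_of_lt_of_le (by positivity) le_sqrt
  have sin_arcsin : sin (arcsin √p) = √p := sin_arcsin (by linarith) (by linarith)
  have sqrt_lt : √p < arcsin √p :=
    sin_arcsin.symm.trans_lt (sin_lt (arcsin_pos.2 sqrt_pos))
  refine ⟨arcsin √p, by nlinarith [pi_lt_d2], ?_, ?_⟩
  · rwa [arcsin_le_iff_le_sin' ⟨by linarith [pi_pos], by linarith [pi_pos]⟩,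
      sin_pi_div_four]
  · rw [sin_arcsin, Real.sq_sqrt (Real.sqrt_pos.1 sqrt_pos).le]

end Averaging

/-! ### Amplitude amplification -/

section Amplification

variable {m : ℕ}

open Circuit Real

/-- The string-wise multiple of `ψ` with the factors `a` where `P` holds and `b` elsewhere. -/
def scale (P : Bits m → Prop) [DecidablePred P] (a b : ℝ) (ψ : QState m) : QState m :=
  fun w => ((if P w then a else b : ℝ) : ℂ) * ψ w

lemma star_dotProduct_scale (P : Bits m → Prop) [DecidablePred P] (a b : ℝ)
    (ψ : QState m) :
    star ψ ⬝ᵥ scale P a b ψ = ((a * prob ψ P + b * prob ψ fun w => ¬P w : ℝ) : ℂ) := by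
  simp only [prob, Finset.mul_sum, Finset.sum_filter, ← Finset.sum_add_distrib]
  rw [dotProduct, Complex.ofReal_sum]
  refine Finset.sum_congr rfl fun w _ => ?_
  rw [scale, Pi.star_apply, mul_left_comm, RCLike.star_def, Complex.conj_mul']
  split_ifs <;> simp

/-- The data of an amplitude amplification: the basis state `w₀`, the circuit `U` which produces
from it the state to be amplified, the circuits `M` and `R` which introduce a sign at the strings
with the property `P` and at `w₀`. Nothing is required of `M` and `R` at strings which differ from
`w₀` at a qubit in `A`; these do not occur since `U` does not change the qubits in `A`. -/
structure IsAmplifier (U M R : Circuit m) (w₀ : Bits m) (A : Set (Fin m)) (P : Bits m → Prop)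
    [DecidablePred P] : Prop where
  preserves : U.Preserves A
  run_mark : ∀ u, Set.EqOn w₀ u A → run M (ket u) = (if P u then -1 else 1 : ℂ) • ket u
  run_reflect : ∀ u, Set.EqOn w₀ u A → run R (ket u) = (if u = w₀ then -1 else 1 : ℂ) • ket u

namespace IsAmplifier

variable {U M R : Circuit m} {w₀ : Bits m} {A : Set (Fin m)} {P : Bits m → Prop} [DecidablePred P]

lemma run_mark_scale (h : IsAmplifier U M R w₀ A P) (a b : ℝ) :
    run M (scale P a b (run U (ket w₀))) = scale P (-a) b (run U (ket w₀)) := by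
  have run_M : ∀ u, scale P a b (run U (ket w₀)) u ≠ 0 →
      run M (ket u) = (if P u then -1 else 1 : ℂ) • ket u := fun u hu =>
    h.run_mark u (h.preserves (right_ne_zero_of_mul hu))
  rw [run_eq_mul_of_ket run_M]
  ext w
  by_cases hw : P w <;> simp [scale, hw]

lemma run_conj_reflect (h : IsAmplifier U M R w₀ A P) {ψ : QState m}
    (hψ : ∀ u, ψ u ≠ 0 → Set.EqOn w₀ u A) :
    run (Circuit.conj U.inv R) ψ =
      ψ - (2 * (star (run U (ket w₀)) ⬝ᵥ ψ)) • run U (ket w₀) := by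
  have run_R : ∀ u, run U.inv ψ u ≠ 0 →
      run R (ket u) = (if u = w₀ then -1 else 1 : ℂ) • ket u := by
    intro u hu
    obtain ⟨v, hv, hvu⟩ := exists_run_ket_ne_zero hu
    exact h.run_reflect u ((hψ v hv).trans (h.preserves.inv hvu))
  have run_R_eq : run R (run U.inv ψ) = run U.inv ψ - (2 * run U.inv ψ w₀) • ket w₀ := by
    rw [run_eq_mul_of_ket run_R]
    ext w
    rcases eq_or_ne w w₀ with rfl | hw
    · simp [ket]
      ring
    · simp [ket, hw]
  rw [run_conj, Circuit.inv_inv, run_R_eq, run_sub, run_smul, run_run_inv, star_run_dotProduct,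
    star_ket_dotProduct]

lemma run_iteration (h : IsAmplifier U M R w₀ A P) {θ : ℝ} (hθ : 0 < θ) (hθ' : θ < π / 2)
    (hP : prob (run U (ket w₀)) P = sin θ ^ 2) (φ : ℝ) :
    run (M ++ Circuit.conj U.inv R)
        (scale P (sin φ / sin θ) (cos φ / cos θ) (run U (ket w₀))) =
      (-1 : ℂ) • scale P (sin (φ + 2 * θ) / sin θ) (cos (φ + 2 * θ) / cos θ) (run U (ket w₀)) := by
  set Φ := run U (ket w₀)
  have sin_ne : sin θ ≠ 0 := (sin_pos_of_pos_of_lt_pi hθ (by linarith)).ne'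
  have cos_ne : cos θ ≠ 0 := (cos_pos_of_mem_Ioo ⟨by linarith, hθ'⟩).ne'
  have overlap : star Φ ⬝ᵥ scale P (-(sin φ / sin θ)) (cos φ / cos θ) Φ = (cos (φ + θ) : ℂ) := by
    rw [star_dotProduct_scale, prob_not_run_ket, hP, ← cos_sq']
    congr 1
    field_simp
    rw [cos_add]
    ring
  have supp (u : Bits m) (hu : scale P (-(sin φ / sin θ)) (cos φ / cos θ) Φ u ≠ 0) :
      Set.EqOn w₀ u A := h.preserves (right_ne_zero_of_mul hu)
  rw [run_append, h.run_mark_scale, h.run_conj_reflect supp, overlap]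
  have sin_eq : sin (φ + 2 * θ) / sin θ = sin φ / sin θ + 2 * cos (φ + θ) := by
    have sub := sin_sub (φ + θ) θ
    rw [add_sub_cancel_right] at sub
    field_simp
    rw [two_mul θ, ← add_assoc, sin_add (φ + θ), sub]
    ring
  have cos_eq : cos (φ + 2 * θ) / cos θ = 2 * cos (φ + θ) - cos φ / cos θ := by
    have sub := cos_sub (φ + θ) θ
    rw [add_sub_cancel_right] at sub
    field_simp
    rw [two_mul θ, ← add_assoc, cos_add (φ + θ), sub]
    ring
  rw [sin_eq, cos_eq]
  ext w
  by_cases hw : P w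
  · simp [scale, hw]
    ring
  · simp [scale, hw]
    ring

/-- Runs `U` and then `j` Grover iterations. -/
def circuit (U M R : Circuit m) (j : ℕ) : Circuit m :=
  U ++ (List.replicate j (M ++ Circuit.conj U.inv R)).flatten

lemma length_circuit (U M R : Circuit m) (j : ℕ) :
    (circuit U M R j).length = U.length + j * (M.length + (2 * U.length + R.length)) := by
  simp [circuit, length_conj, length_inv]

lemma run_circuit (h : IsAmplifier U M R w₀ A P) {θ : ℝ} (hθ : 0 < θ) (hθ' : θ < π / 2)
    (hP : prob (run U (ket w₀)) P = sin θ ^ 2) (j : ℕ) :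
    run (circuit U M R j) (ket w₀) = (-1 : ℂ) ^ j •
      scale P (sin ((2 * j + 1) * θ) / sin θ) (cos ((2 * j + 1) * θ) / cos θ)
        (run U (ket w₀)) := by
  induction j with
  | zero =>
    have sin_ne : sin θ ≠ 0 := (sin_pos_of_pos_of_lt_pi hθ (by linarith)).ne'
    have cos_ne : cos θ ≠ 0 := (cos_pos_of_mem_Ioo ⟨by linarith, hθ'⟩).ne'
    ext w
    simp [circuit, scale, sin_ne, cos_ne]
  | succ j ih =>
    have angle : (2 * (j + 1 : ℕ) + 1) * θ = (2 * j + 1) * θ + 2 * θ := by push_cast; ring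
    rw [circuit, List.replicate_succ', List.flatten_append, ← List.append_assoc, List.flatten_cons,
      List.flatten_nil, List.append_nil, run_append, ← circuit, ih, run_smul,
      h.run_iteration hθ hθ' hP, smul_smul, pow_succ, angle]

lemma prob_circuit (h : IsAmplifier U M R w₀ A P) {θ : ℝ} (hθ : 0 < θ) (hθ' : θ < π / 2)
    (hP : prob (run U (ket w₀)) P = sin θ ^ 2) (j : ℕ) :
    prob (run (circuit U M R j) (ket w₀)) P = sin ((2 * j + 1) * θ) ^ 2 := by
  have sin_ne : sin θ ≠ 0 := (sin_pos_of_pos_of_lt_pi hθ (by linarith)).ne'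
  have sq_norm (w : Bits m) (hw : P w) :
      ‖run (circuit U M R j) (ket w₀) w‖ ^ 2 =
        (sin ((2 * j + 1) * θ) / sin θ) ^ 2 * ‖run U (ket w₀) w‖ ^ 2 := by
    rw [h.run_circuit hθ hθ' hP, Pi.smul_apply, scale, if_pos hw, norm_smul, norm_mul, norm_pow,
      norm_neg, norm_one, one_pow, one_mul, mul_pow, Complex.norm_real, Real.norm_eq_abs, sq_abs]
  rw [prob, Finset.sum_congr rfl fun w hw => sq_norm w (Finset.mem_filter.1 hw).2,
    ← Finset.mul_sum, ← prob, hP, div_pow, div_mul_cancel₀ _ (pow_ne_zero 2 sin_ne)]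

end IsAmplifier

end Amplification

/-! ### Prediction and evaluation of functions -/

section Prediction

variable {n m k : ℕ}

/-- The strings which vanish outside of `B`. -/
def supported (B : Finset (Fin n)) : Finset (Bits n) :=
  Fintype.piFinset fun i => if i ∈ B then Finset.univ else {0}

lemma mem_supported {B : Finset (Fin n)} {x : Bits n} : x ∈ supported B ↔ ∀ i ∉ B, x i = 0 := by
  rw [supported, Fintype.mem_piFinset]
  refine forall_congr' fun i => ?_
  by_cases hi : i ∈ B <;> simp [hi]

lemma card_supported (B : Finset (Fin n)) : (supported B).card = 2 ^ B.card := by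
  simp [supported, Fintype.card_piFinset, apply_ite Finset.card]

-- Both sides of the claim arise from the double sum of `φ (x + s)` over all `x` and all `s` in
-- `supported B`.
lemma sum_div_eq_sum_supported_div {B : Finset (Fin n)} {φ : Bits n → ℂ}
    (hφ : ∀ x d, (∀ i ∈ B, d i = 0) → φ (x + d) = φ x) :
    (∑ x, φ x) / 2 ^ n = (∑ x ∈ supported B, φ x) / 2 ^ B.card := by
  have sum_supported_add (x : Bits n) :
      ∑ s ∈ supported B, φ (x + s) = ∑ s ∈ supported B, φ s := by
    let x' : Bits n := fun i => if i ∈ B then x i else 0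
    have shift_supported (s : Bits n) : x' + s ∈ supported B ↔ s ∈ supported B := by
      simp only [mem_supported]
      exact forall₂_congr fun i hi => by simp [x', hi]
    refine Finset.sum_equiv (Equiv.addLeft x') (fun s => (shift_supported s).symm) fun s _ => ?_
    rw [Equiv.coe_addLeft, ← hφ (x' + s) (x - x') fun i hi => by simp [x', hi]]
    congr 1
    abel
  have double_sum : 2 ^ B.card * ∑ x, φ x = 2 ^ n * ∑ s ∈ supported B, φ s :=
    calc 2 ^ B.card * ∑ x, φ x = ∑ s ∈ supported B, ∑ x, φ (x + s) := by
          have sum_add (s : Bits n) : ∑ x, φ (x + s) = ∑ x, φ x :=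
            Equiv.sum_comp (Equiv.addRight s) φ
          rw [Finset.sum_congr rfl fun s _ => sum_add s, Finset.sum_const, card_supported,
            nsmul_eq_mul]
          push_cast
          rfl
      _ = 2 ^ n * ∑ s ∈ supported B, φ s := by
          rw [Finset.sum_comm, Finset.sum_congr rfl fun x _ => sum_supported_add x]
          simp
  rw [div_eq_div_iff (pow_ne_zero _ two_ne_zero) (pow_ne_zero _ two_ne_zero), mul_comm, double_sum,
    mul_comm]

lemma padZero_castLE (hn : n ≤ m) (x : Bits n) (i : Fin n) :
    padZero m x (Fin.castLE hn i) = x i := by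
  simp [padZero]

lemma padZero_eq_sum_single (hn : n ≤ m) (x : Bits n) :
    padZero m x = ∑ i, Pi.single (Fin.castLE hn i) (x i) := by
  ext q
  rw [Finset.sum_apply]
  by_cases hq : (q : ℕ) < n
  · obtain ⟨i, rfl⟩ : ∃ i, Fin.castLE hn i = q := ⟨⟨q, hq⟩, rfl⟩
    simp [padZero_castLE, Pi.single_apply]
  · rw [padZero, dif_neg hq]
    refine (Finset.sum_eq_zero fun i _ => Pi.single_eq_of_ne ?_ _).symm
    rintro rfl
    exact hq i.isLt

lemma sum_single_supported {α : Type*} [DecidableEq α] {B : Finset (Fin n)} {c : Bits n}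
    (hc : c ∈ supported B) (a : Fin n → α) :
    ∑ i ∈ B, Pi.single (M := fun _ => ZMod 2) (a i) (c i) = ∑ i, Pi.single (a i) (c i) :=
  Finset.sum_subset B.subset_univ fun i _ hi => by rw [mem_supported.1 hc i hi, Pi.single_zero]

namespace Circuit

lemma Computes.apply_eq {F : Circuit k} {hk : n ≤ k} {f : Bits n → Bits n}
    (hF : F.Computes hk f) {x : Bits n} {v : Bits k} (hv : run F (ket (padZero k x)) v ≠ 0)
    (i : Fin n) : v (Fin.castLE hk i) = f x i := by
  have prob_not : prob (run F (ket (padZero k x)))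
      (fun w => ¬∀ i, w (Fin.castLE hk i) = f x i) = 0 := by
    rw [prob_not_run_ket, ← outProb_eq_prob F hk, hF x, sub_self]
  by_contra hne
  have norm_sq_eq_zero := (Finset.sum_eq_zero_iff_of_nonneg fun w _ => sq_nonneg _).1 prob_not v
    (by simpa using ⟨i, hne⟩)
  simp [hv] at norm_sq_eq_zero

lemma Computes.apply_eq_self {F : Circuit k} {hk : n ≤ k} {f : Bits n → Bits n}
    (hF : F.Computes hk f) (x : Bits n) {i : Fin n} (hi : Fin.castLE hk i ∉ F.touched) :
    f x i = x i := by
  obtain ⟨v, hv⟩ : ∃ v, run F (ket (padZero k x)) v ≠ 0 := by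
    by_contra! h
    simpa [prob, h] using F.prob_run_ket_true (padZero k x)
  rw [← hF.apply_eq hv, ← padZero_castLE hk x i]
  exact (F.preserves_compl_touched hv hi).symm

/-- The expectation of the sign of the qubit `q` after a run on a basis state. -/
noncomputable def expectSgn (C : Circuit m) (q : Fin m) (u : Bits m) : ℂ :=
  ∑ v, sgn (v q) * (‖run C (ket u) v‖ ^ 2 : ℝ)

lemma expectSgn_add (C : Circuit m) {q : Fin m} {d : Bits m} (hd : ∀ i ∈ C.touched, d i = 0)
    (hq : d q = 0) (u : Bits m) : C.expectSgn q (u + d) = C.expectSgn q u := by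
  rw [expectSgn, ← Equiv.sum_comp (Equiv.addRight d)]
  simp [run_ket_add C hd, hq, expectSgn]

lemma expectSgn_append {C D : Circuit m} {u u' : Bits m} (h : run C (ket u) = ket u')
    (q : Fin m) : (C ++ D).expectSgn q u = D.expectSgn q u' := by
  simp only [expectSgn, run_append, h]

lemma expectSgn_relabel {M : ℕ} (e : Fin m ↪ Fin M) (C : Circuit m) (q : Fin m) (u : Bits m)
    (w : Bits M) : (C.relabel e).expectSgn (e q) (Function.extend e u w) = C.expectSgn q u := by
  have extend_inj := Function.extend_injective e.injective w
  refine (Fintype.sum_of_injective _ extend_inj _ _ (fun v hv => ?_) fun v => ?_).symm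
  · rw [run_relabel_ket_extend, Finset.sum_apply, Finset.sum_eq_zero]
    · simp
    · intro v' _
      have : v ≠ Function.extend e v' w := fun h => hv ⟨v', h.symm⟩
      simp [ket, this]
  · rw [run_relabel_ket_extend, e.injective.extend_apply]
    simp [ket, extend_inj.eq_iff]

lemma run_conj_pauliZ_ket_self (C : Circuit m) (q : Fin m) (u : Bits m) :
    run (conj C [Gate.pauliZ q]) (ket u) u = C.expectSgn q u := by
  have run_pauliZ : run [Gate.pauliZ q] (run C (ket u)) =
      fun v => sgn (v q) * run C (ket u) v :=
    run_eq_mul_of_ket fun v _ => Gate.apply_pauliZ_ket q v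
  rw [run_conj, ← star_ket_dotProduct u (run C.inv _), ← star_run_dotProduct, run_pauliZ,
    expectSgn, dotProduct]
  refine Finset.sum_congr rfl fun v _ => ?_
  rw [Complex.ofReal_pow, ← Complex.conj_mul', Pi.star_apply, Complex.star_def]
  ring

lemma two_mul_outProb_sub_one (C : Circuit m) (hn : n ≤ m) (hm : 1 ≤ m) (x : Bits n)
    (b : ZMod 2) :
    ((2 * C.outProb hn hm x (fun _ => b) - 1 : ℝ) : ℂ) =
      sgn b * C.expectSgn (Fin.castLE hm 0) (padZero m x) := by
  have sgn_mul_sgn (a : ZMod 2) : sgn b * sgn a = 2 * (if a = b then 1 else 0) - 1 := by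
    rcases zmod_two_cases a with rfl | rfl <;> rcases zmod_two_cases b with rfl | rfl <;>
      norm_num [sgn_one]
  rw [outProb_eq_prob, ← C.prob_run_ket_true (padZero m x), expectSgn, prob, prob]
  simp only [Fin.forall_fin_one, Finset.filter_true, Finset.sum_filter, Finset.mul_sum, ← mul_assoc,
    sgn_mul_sgn, ← Finset.sum_sub_distrib]
  rw [Complex.ofReal_sum]
  refine Finset.sum_congr rfl fun w _ => ?_
  split_ifs <;> (push_cast; ring)

/-- The correlation of the predictor's answer with the bit `h(y, x)`, as a function of `x`. -/
noncomputable def correlation (G : Circuit m) (hm₁ : 1 ≤ m) (z y x : Bits n) : ℂ :=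
  sgn (y ⬝ᵥ x) * G.expectSgn (Fin.castLE hm₁ 0) (padZero m (Fin.append z x))

variable {G : Circuit m} {hm : n + n ≤ m} {hm₁ : 1 ≤ m}

lemma two_mul_predProb_sub_one (f : Equiv.Perm (Bits n)) (y : Bits n) :
    ((2 * G.predProb hm hm₁ f y - 1 : ℝ) : ℂ) =
      (∑ x, G.correlation hm₁ (f y) y x) / 2 ^ n := by
  have sum_correlation : ∑ x, G.correlation hm₁ (f y) y x =
      ((∑ x, (2 * G.outProb hm hm₁ (Fin.append (f y) x) (fun _ => y ⬝ᵥ x) - 1) : ℝ) : ℂ) := by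
    simp only [Complex.ofReal_sum, two_mul_outProb_sub_one, correlation]
  rw [sum_correlation, Circuit.predProb, Finset.sum_sub_distrib, ← Finset.mul_sum]
  simp only [tildeMap, Equiv.prodCongr_apply, Prod.map, Equiv.refl_apply, hardPred]
  push_cast
  field_simp
  simp

/-- The qubit of a predictor which holds the `i`-th bit of the first string. -/
def firstInput (hm : n + n ≤ m) (i : Fin n) : Fin m := Fin.castLE hm (Fin.castAdd n i)

/-- The qubit of a predictor which holds the `i`-th bit of the second string. -/
def secondInput (hm : n + n ≤ m) (i : Fin n) : Fin m := Fin.castLE hm (Fin.natAdd n i)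

lemma padZero_append (hm : n + n ≤ m) (z x : Bits n) :
    padZero m (Fin.append z x) =
      ∑ i, Pi.single (firstInput hm i) (z i) + ∑ i, Pi.single (secondInput hm i) (x i) := by
  simp only [padZero_eq_sum_single hm, Fin.sum_univ_add, Fin.append_left, Fin.append_right,
    firstInput, secondInput]

lemma correlation_add {d : Bits n} (hd : ∀ i, secondInput hm i ∈ G.touched → d i = 0)
    (z y x : Bits n) :
    G.correlation hm₁ z y (x + d) = sgn (y ⬝ᵥ d) * G.correlation hm₁ z y x := by
  let d' : Bits m := ∑ i, Pi.single (secondInput hm i) (d i)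
  have padZero_append_add :
      padZero m (Fin.append z (x + d)) = padZero m (Fin.append z x) + d' := by
    simp only [padZero_append hm, Pi.add_apply, Pi.single_add, Finset.sum_add_distrib, add_assoc,
      d']
  have eq_zero {q : Fin m} (hq : ∀ i, secondInput hm i = q → d i = 0) : d' q = 0 := by
    refine (Finset.sum_apply _ _ _).trans (Finset.sum_eq_zero fun i _ => ?_)
    rcases eq_or_ne (secondInput hm i) q with rfl | hne
    · rw [Pi.single_eq_same, hq i rfl]
    · rw [Pi.single_eq_of_ne' hne]
  have first_ne (i : Fin n) : secondInput hm i ≠ Fin.castLE hm₁ 0 := by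
    simp only [ne_eq, Fin.ext_iff, secondInput, Fin.val_castLE, Fin.val_natAdd, Fin.val_zero]
    have := i.pos
    lia
  rw [correlation, padZero_append_add,
    expectSgn_add G (fun q hq => eq_zero fun i hi => hd i (hi ▸ hq))
      (eq_zero fun i hi => absurd hi (first_ne i)), dotProduct_add, AddChar.map_add_eq_mul,
    correlation]
  ring

lemma apply_eq_zero_of_predProb_ne {f : Equiv.Perm (Bits n)} {y : Bits n}
    (hy : G.predProb hm hm₁ f y ≠ 1 / 2) {i : Fin n} (hi : secondInput hm i ∉ G.touched) :
    y i = 0 := by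
  by_contra h
  have hyi : sgn (y ⬝ᵥ Pi.single i 1) = -1 := by
    rw [dotProduct_single_one, (zmod_two_cases (y i)).resolve_left h, sgn_one]
  have sum_eq_neg : ∑ x, G.correlation hm₁ (f y) y x = -∑ x, G.correlation hm₁ (f y) y x := by
    conv_lhs => rw [← Equiv.sum_comp (Equiv.addRight (Pi.single i 1 : Bits n))]
    rw [← Finset.sum_neg_distrib]
    refine Finset.sum_congr rfl fun x _ => ?_
    rw [Equiv.coe_addRight, correlation_add (hm := hm) ?_, hyi, neg_one_mul]
    intro j hj
    rw [Pi.single_eq_of_ne]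
    rintro rfl
    exact hi hj
  have key := two_mul_predProb_sub_one (G := G) (hm := hm) (hm₁ := hm₁) f y
  rw [self_eq_neg.1 sum_eq_neg, zero_div, Complex.ofReal_eq_zero] at key
  exact hy (by linarith)

lemma two_mul_predProb_sub_one_eq_sum_supported (f : Equiv.Perm (Bits n)) {y : Bits n}
    {B : Finset (Fin n)} (hB : ∀ i, secondInput hm i ∈ G.touched → i ∈ B)
    (hy : y ∈ supported B) :
    ((2 * G.predProb hm hm₁ f y - 1 : ℝ) : ℂ) =
      (∑ x ∈ supported B, G.correlation hm₁ (f y) y x) / 2 ^ B.card := by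
  rw [two_mul_predProb_sub_one]
  refine sum_div_eq_sum_supported_div fun x d hd => ?_
  have orthogonal : y ⬝ᵥ d = 0 := Finset.sum_eq_zero fun i _ => by
    by_cases hi : i ∈ B
    · rw [hd i hi, mul_zero]
    · rw [mem_supported.1 hy i hi, zero_mul]
  rw [correlation_add fun i hi => hd i (hB i hi), orthogonal, AddChar.map_zero_eq_one, one_mul]

end Circuit

end Prediction

/-! ### The inverter -/

section Layout

variable {n k m M : ℕ}

lemma exists_equiv_fin_extending {X : Type*} [Finite X] (a : Fin n ↪ X) :
    ∃ (M : ℕ) (_ : n ≤ M) (e : X ≃ Fin M), ∀ i, (e (a i) : ℕ) = i := by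
  cases nonempty_fintype X
  have hM : n ≤ Fintype.card X := by simpa using Fintype.card_le_of_embedding a
  let pos := Function.extend a (Fin.castLE hM) (Fintype.equivFin X)
  have pos_apply (i : Fin n) : pos (a i) = Fin.castLE hM i := a.injective.extend_apply _ _ i
  have pos_injOn : Set.InjOn pos (Set.range a) :=
    Function.Injective.injOn_range fun i j h => by simpa [pos_apply] using h
  obtain ⟨e, he⟩ := Set.MapsTo.exists_equiv_extend_of_card_eq (t := Finset.univ) (f := pos)
    (by simp) (fun _ _ => by simp) pos_injOn
  refine ⟨_, hM, e.trans (Equiv.subtypeUnivEquiv Finset.mem_univ), fun i => ?_⟩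
  exact congrArg Fin.val ((he _ ⟨i, rfl⟩).trans (pos_apply i))

/-- The uses of the qubits of the inverter: a candidate for the preimage, the string to be
inverted, the auxiliary qubits of the evaluator, the qubits of the predictor, and a flag. -/
inductive Role (n k m : ℕ) : Type
  | cand (i : Fin n)
  | target (i : Fin n)
  | work (j : Fin k)
  | pred (j : Fin m)
  | flag
  deriving DecidableEq, Fintype

open Role

/-- The bits of the inverter when the candidate is `x`, the string to be inverted is `z`, the
predictor holds `v`, and all other bits are zero. -/
def bitsOf (x z : Bits n) (v : Bits m) : Role n k m → ZMod 2
  | cand i => x i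
  | target i => z i
  | work _ => 0
  | pred j => v j
  | flag => 0

/-- The string in which the bit with role `r` is `b r`. Each role comes with a second qubit, which
is auxiliary to the sign changes and holds a zero. -/
def place (e : Role n k m ⊕ Role n k m ≃ Fin M) (b : Role n k m → ZMod 2) : Bits M :=
  fun q => Sum.elim b 0 (e.symm q)

variable {e : Role n k m ⊕ Role n k m ≃ Fin M} {B : Finset (Fin n)}

@[simp] lemma place_inl (b : Role n k m → ZMod 2) (r : Role n k m) :
    place e b (e (.inl r)) = b r := by
  simp [place]

@[simp] lemma place_inr (b : Role n k m → ZMod 2) (r : Role n k m) :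
    place e b (e (.inr r)) = 0 := by
  simp [place]

lemma bits_ext {u w : Bits M} (hl : ∀ r, u (e (.inl r)) = w (e (.inl r)))
    (hr : ∀ r, u (e (.inr r)) = w (e (.inr r))) : u = w := by
  ext q
  obtain ⟨r | r, rfl⟩ := e.surjective q
  exacts [hl r, hr r]

lemma padZero_eq_place (he : ∀ i, (e (.inl (cand i)) : ℕ) = i) (hM : n ≤ M) (x : Bits n) :
    padZero M x = place e (bitsOf x 0 0) := by
  have cand_eq (i : Fin n) : e (.inl (cand i)) = Fin.castLE hM i := Fin.ext (he i)
  have eq_zero (r : Role n k m ⊕ Role n k m) (hr : ∀ i, r ≠ .inl (cand i)) :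
      padZero M x (e r) = 0 := by
    refine dif_neg fun h => hr ⟨e r, h⟩ (e.injective (Fin.ext ?_))
    rw [he]
  refine bits_ext (e := e) (fun r => ?_) fun r => by rw [eq_zero _ (by simp), place_inr]
  rw [place_inl]
  cases r with
  | cand i => rw [cand_eq, padZero_castLE, bitsOf]
  | _ => exact eq_zero _ (by simp)

namespace Circuit

lemma run_cnots_ket_place {a t : Fin n → Role n k m} (h : ∀ i j, a i ≠ t j)
    {c : Bits n} (hc : c ∈ supported B) {b b' : Role n k m → ZMod 2} (hb : ∀ i, b (a i) = c i)
    (hb' : b + ∑ i, Pi.single (t i) (c i) = b') :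
    run (cnots (fun i => e (.inl (a i))) (fun i => e (.inl (t i))) B) (ket (place e b)) =
      ket (place e b') := by
  rw [run_cnots_ket (fun i j => by simpa using h i j)]
  simp only [place_inl, hb]
  rw [sum_single_supported hc, ← hb']
  congr 1
  refine bits_ext (e := e) (fun r => ?_) fun r => ?_ <;>
    simp [Finset.sum_apply, Pi.single_apply]

/-- Moves the string to be inverted from the input qubits to the target qubits. -/
noncomputable def load (e : Role n k m ⊕ Role n k m ≃ Fin M) (B : Finset (Fin n)) : Circuit M :=
  cnots (fun i => e (.inl (cand i))) (fun i => e (.inl (target i))) B ++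
    cnots (fun i => e (.inl (target i))) (fun i => e (.inl (cand i))) B

lemma length_load_le : (load e B).length ≤ 2 * B.card := by
  rw [load, List.length_append]
  linarith [length_cnots_le (fun i => e (.inl (cand i))) (fun i => e (.inl (target i))) B,
    length_cnots_le (fun i => e (.inl (target i))) (fun i => e (.inl (cand i))) B]

lemma run_load_ket {z : Bits n} (hz : z ∈ supported B) :
    run (load e B) (ket (place e (bitsOf z 0 0))) = ket (place e (bitsOf 0 z 0)) := by
  rw [load, run_append, run_cnots_ket_place (by simp) hz (b' := bitsOf z z 0) (fun i => rfl),
    run_cnots_ket_place (by simp) hz (fun i => rfl)]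
  all_goals
    ext r
    cases r <;> simp [bitsOf, Pi.single_apply, ZModModule.add_self]

lemma preserves_cnots {α : Type*} {a t : α → Fin m} (h : ∀ i j, a i ≠ t j) (S : Finset α) :
    (cnots a t S).Preserves (t '' S)ᶜ := by
  intro u w hw q hq
  rw [run_cnots_ket h] at hw
  rw [eq_of_ket_ne_zero hw, Pi.add_apply, Finset.sum_apply, Finset.sum_eq_zero, add_zero]
  intro i hi
  refine Pi.single_eq_of_ne ?_ _
  rintro rfl
  exact hq ⟨i, hi, rfl⟩

end Circuit

end Layout

section Query

variable {n k m M : ℕ} {e : Role n k m ⊕ Role n k m ≃ Fin M} {B : Finset (Fin n)}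
  {G : Circuit m} {hm : n + n ≤ m} {hm₁ : 1 ≤ m}

open Role

/-- The qubits of the candidate. -/
def candEmb (e : Role n k m ⊕ Role n k m ≃ Fin M) : Fin n ↪ Fin M :=
  ⟨fun i => e (.inl (cand i)), fun i j h => by simpa using h⟩

@[simp] lemma candEmb_apply (i : Fin n) : candEmb e i = e (.inl (cand i)) := rfl

/-- The qubits of the predictor. -/
def predEmb (e : Role n k m ⊕ Role n k m ≃ Fin M) : Fin m ↪ Fin M :=
  ⟨fun j => e (.inl (pred j)), fun i j h => by simpa using h⟩

@[simp] lemma predEmb_apply (j : Fin m) : predEmb e j = e (.inl (pred j)) := rfl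

lemma eqOn_compl_candEmb_iff {a z : Bits n} (ha : a ∈ supported B) {w : Bits M} :
    (∀ q ∉ B.map (candEmb e), w q = place e (bitsOf a z 0) q) ↔
      ∃ x ∈ supported B, w = place e (bitsOf x z 0) := by
  constructor
  · intro hw
    refine ⟨w ∘ candEmb e, mem_supported.2 fun i hi => ?_,
      bits_ext (e := e) (fun r => ?_) fun r => ?_⟩
    · rw [← mem_supported.1 ha i hi]
      exact (hw _ (by simpa)).trans (place_inl _ _)
    · cases r with
      | cand i => rw [place_inl]; rfl
      | _ => exact (hw _ (by simp)).trans (by rw [place_inl, place_inl]; rfl)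
    · exact (hw _ (by simp)).trans (by rw [place_inr, place_inr])
  · rintro ⟨x, hx, rfl⟩ q hq
    obtain ⟨r | r, rfl⟩ := e.surjective q
    · rw [place_inl, place_inl]
      cases r with
      | cand i =>
        have hi : i ∉ B := by simpa using hq
        exact (mem_supported.1 hx i hi).trans (mem_supported.1 ha i hi).symm
      | _ => rfl
    · rw [place_inr, place_inr]

namespace Circuit

/-- Runs the predictor on the target and on the candidate. -/
noncomputable def predict (e : Role n k m ⊕ Role n k m ≃ Fin M) (B : Finset (Fin n))
    (G : Circuit m) (hm : n + n ≤ m) : Circuit M :=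
  (cnots (fun i => e (.inl (target i))) (fun i => e (.inl (pred (firstInput hm i)))) B ++
    cnots (fun i => e (.inl (cand i))) (fun i => e (.inl (pred (secondInput hm i)))) B) ++
    G.relabel (predEmb e)

lemma length_predict_le : (predict e B G hm).length ≤ 2 * B.card + G.length := by
  simp only [predict, List.length_append, length_relabel]
  linarith [length_cnots_le (fun i => e (.inl (target i)))
      (fun i => e (.inl (pred (firstInput hm i)))) B,
    length_cnots_le (fun i => e (.inl (cand i))) (fun i => e (.inl (pred (secondInput hm i)))) B]

lemma expectSgn_predict {x z : Bits n} (hx : x ∈ supported B) (hz : z ∈ supported B) (q : Fin m) :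
    (predict e B G hm).expectSgn (e (.inl (pred q))) (place e (bitsOf x z 0)) =
      G.expectSgn q (padZero m (Fin.append z x)) := by
  have run_inputs :
      run (cnots (fun i => e (.inl (target i))) (fun i => e (.inl (pred (firstInput hm i)))) B ++
        cnots (fun i => e (.inl (cand i))) (fun i => e (.inl (pred (secondInput hm i)))) B)
        (ket (place e (bitsOf x z 0))) =
      ket (place e (bitsOf x z (padZero m (Fin.append z x)))) := by
    rw [run_append, run_cnots_ket_place (by simp) hz
        (b' := bitsOf x z (∑ i, Pi.single (firstInput hm i) (z i))) (fun i => rfl),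
      run_cnots_ket_place (by simp) hx (fun i => rfl)]
    all_goals
      ext r
      cases r <;> simp [bitsOf, Pi.single_apply, padZero_append hm]
  have extend_eq (v : Bits m) : place e (bitsOf x z v) =
      Function.extend (predEmb e) v (place e (bitsOf x z 0)) := by
    have extend_apply' {q : Fin M} (hq : ∀ j, predEmb e j ≠ q) :
        Function.extend (predEmb e) v (place e (bitsOf x z 0)) q = place e (bitsOf x z 0) q :=
      Function.extend_apply' _ _ _ fun ⟨j, hj⟩ => hq j hj
    refine bits_ext (e := e) (fun r => ?_) fun r => by
      rw [extend_apply' (by simp), place_inr, place_inr]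
    cases r with
    | pred j => exact (place_inl _ _).trans ((predEmb e).injective.extend_apply _ _ j).symm
    | _ => rw [extend_apply' (by simp), place_inl, place_inl]; rfl
  rw [predict, expectSgn_append run_inputs, extend_eq]
  exact expectSgn_relabel (predEmb e) G q _ _

/-- The qubits of the predictor which are in use. -/
def usedByPredict (B : Finset (Fin n)) (G : Circuit m) (hm : n + n ≤ m) : Finset (Fin m) :=
  G.touched ∪ B.image (firstInput hm) ∪ B.image (secondInput hm)

lemma card_usedByPredict_le : (usedByPredict B G hm).card ≤ 2 * G.length + 2 * B.card := by
  have card_union_le := (Finset.card_union_le (G.touched ∪ B.image (firstInput hm))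
    (B.image (secondInput hm))).trans (Nat.add_le_add_right (Finset.card_union_le _ _) _)
  have := G.card_touched_le
  have := B.card_image_le (f := firstInput hm)
  have := B.card_image_le (f := secondInput hm)
  rw [usedByPredict]
  lia

lemma preserves_predict :
    (predict e B G hm).Preserves ((usedByPredict B G hm).map (predEmb e) : Set (Fin M))ᶜ := by
  refine .append (.append ((preserves_cnots (by simp) B).mono ?_)
    ((preserves_cnots (by simp) B).mono ?_)) ((preserves_compl_touched _).mono ?_)
  · rw [Set.compl_subset_compl]
    rintro _ ⟨i, hi, rfl⟩
    refine Finset.mem_map_of_mem (predEmb e) ?_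
    simp [usedByPredict, Finset.mem_image_of_mem _ (Finset.mem_coe.1 hi)]
  · rw [Set.compl_subset_compl]
    rintro _ ⟨i, hi, rfl⟩
    refine Finset.mem_map_of_mem (predEmb e) ?_
    simp [usedByPredict, Finset.mem_image_of_mem _ (Finset.mem_coe.1 hi)]
  · rw [touched_relabel, Set.compl_subset_compl, Finset.coe_subset, Finset.map_subset_map,
      usedByPredict, Finset.union_assoc]
    exact Finset.subset_union_left

lemma preserves_pauliZ (q : Fin m) (A : Set (Fin m)) : Preserves [Gate.pauliZ q] A := by
  intro u w hw
  rw [run_cons, run_nil, Gate.apply_pauliZ_ket] at hw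
  rw [eq_of_ket_ne_zero (right_ne_zero_of_mul hw)]
  exact Set.eqOn_refl u A

/-- A circuit whose diagonal entries are the expectations of the sign of the predicted bit. -/
noncomputable def query (e : Role n k m ⊕ Role n k m ≃ Fin M) (B : Finset (Fin n))
    (G : Circuit m) (hm : n + n ≤ m) (hm₁ : 1 ≤ m) : Circuit M :=
  conj (predict e B G hm) [Gate.pauliZ (e (.inl (pred (Fin.castLE hm₁ 0))))]

lemma preserves_query : (query e B G hm hm₁).Preserves
    ((usedByPredict B G hm).map (predEmb e) : Set (Fin M))ᶜ :=
  preserves_predict.conj (preserves_pauliZ _ _)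

lemma run_query_ket_place {x x' z : Bits n} (hx : x ∈ supported B) (hz : z ∈ supported B) :
    run (query e B G hm hm₁) (ket (place e (bitsOf x z 0))) (place e (bitsOf x' z 0)) =
      if x' = x then G.expectSgn (Fin.castLE hm₁ 0) (padZero m (Fin.append z x)) else 0 := by
  split_ifs with h
  · rw [h, query, run_conj_pauliZ_ket_self, expectSgn_predict hx hz]
  · contrapose! h
    ext i
    have := preserves_query h (x := e (.inl (cand i))) (by simp)
    simpa [bitsOf] using this.symm

lemma run_hads_ket_place {a z : Bits n} (ha : a ∈ supported B) :
    run (hads (B.map (candEmb e))) (ket (place e (bitsOf a z 0))) =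
      ∑ x ∈ supported B, (invSqrtTwo ^ B.card * sgn (a ⬝ᵥ x)) • ket (place e (bitsOf x z 0)) := by
  have dotProduct_eq (x : Bits n) : ∑ i ∈ B, x i * a i = a ⬝ᵥ x := by
    rw [dotProduct_comm, dotProduct]
    exact Finset.sum_subset B.subset_univ fun i _ hi => by
      rw [mem_supported.1 ha i hi, mul_zero]
  ext w
  rw [run_hads_ket_apply, Finset.card_map, Finset.sum_map, Finset.sum_apply]
  split_ifs with hw
  · obtain ⟨x, hx, rfl⟩ := (eqOn_compl_candEmb_iff ha).1 hw
    have place_ne {x' : Bits n} (h : x' ≠ x) :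
        place e (bitsOf x z 0) ≠ place e (bitsOf x' z 0) := by
      contrapose! h
      ext i
      simpa [bitsOf] using (congrFun h (candEmb e i)).symm
    rw [Finset.sum_eq_single_of_mem x hx fun x' _ hne => by simp [ket, place_ne hne]]
    simp [ket, bitsOf, dotProduct_eq]
  · refine (Finset.sum_eq_zero fun x hx => ?_).symm
    have : w ≠ place e (bitsOf x z 0) := fun h => hw ((eqOn_compl_candEmb_iff ha).2 ⟨x, hx, h⟩)
    simp [ket, this]

/-- From the all-zero candidate, this circuit produces the preimage with an amplitude equal to the
bias of the predictor. -/
noncomputable def guess (e : Role n k m ⊕ Role n k m ≃ Fin M) (B : Finset (Fin n))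
    (G : Circuit m) (hm : n + n ≤ m) (hm₁ : 1 ≤ m) : Circuit M :=
  conj (hads (B.map (candEmb e))) (query e B G hm hm₁)

lemma run_guess_ket_place {a z : Bits n} (ha : a ∈ supported B) (hz : z ∈ supported B) :
    run (guess e B G hm hm₁) (ket (place e (bitsOf 0 z 0))) (place e (bitsOf a z 0)) =
      (∑ x ∈ supported B, G.correlation hm₁ z a x) / 2 ^ B.card := by
  have zero_mem : (0 : Bits n) ∈ supported B := mem_supported.2 fun _ _ => rfl
  have star_invSqrtTwo_pow : star (invSqrtTwo ^ B.card) * invSqrtTwo ^ B.card = (2 ^ B.card)⁻¹ := by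
    rw [star_pow, star_invSqrtTwo, ← mul_pow, ← sq, invSqrtTwo_sq, one_div, inv_pow]
  rw [guess, run_conj, ← star_ket_dotProduct (place e (bitsOf a z 0)) (run (inv _) _),
    ← star_run_dotProduct, run_hads_ket_place ha, run_hads_ket_place zero_mem, run_sum, star_sum,
    sum_dotProduct, Finset.sum_div]
  refine Finset.sum_congr rfl fun x hx => ?_
  rw [star_smul, smul_dotProduct, star_ket_dotProduct, Finset.sum_apply,
    Finset.sum_eq_single_of_mem x hx]
  · rw [run_smul, Pi.smul_apply, run_query_ket_place hx hz, if_pos rfl, zero_dotProduct,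
      AddChar.map_zero_eq_one, star_mul, star_sgn, correlation, div_eq_mul_inv,
      ← star_invSqrtTwo_pow, smul_eq_mul, smul_eq_mul]
    ring
  · intro x' hx' hne
    rw [run_smul, Pi.smul_apply, run_query_ket_place hx' hz, if_neg hne.symm, smul_zero]

end Circuit

end Query

section Inverter

variable {n k m M : ℕ} {e : Role n k m ⊕ Role n k m ≃ Fin M} {B : Finset (Fin n)}
  {F : Circuit k} {hk : n ≤ k} {f : Equiv.Perm (Bits n)}
  {G : Circuit m} {hm : n + n ≤ m} {hm₁ : 1 ≤ m}

open Role

/-- The qubits of the evaluator: its input is the candidate. -/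
def evalEmb (e : Role n k m ⊕ Role n k m ≃ Fin M) : Fin k ↪ Fin M where
  toFun j := e (.inl (if h : (j : ℕ) < n then cand ⟨j, h⟩ else work j))
  inj' i j hij := by
    have := Sum.inl_injective (e.injective hij)
    split_ifs at this <;> simp_all [Fin.ext_iff]

lemma evalEmb_apply (j : Fin k) :
    evalEmb e j = e (.inl (if h : (j : ℕ) < n then cand ⟨j, h⟩ else work j)) := rfl

lemma evalEmb_castLE (i : Fin n) : evalEmb e (Fin.castLE hk i) = e (.inl (cand i)) := by
  rw [evalEmb_apply, dif_pos (show (Fin.castLE hk i : ℕ) < n from i.isLt)]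
  rfl

lemma evalEmb_ne {r : Role n k m} (hr : ∀ i, r ≠ cand i) (hr' : ∀ j, r ≠ work j) (j : Fin k) :
    evalEmb e j ≠ e (.inl r) := by
  rw [evalEmb_apply, ne_eq, EmbeddingLike.apply_eq_iff_eq, Sum.inl.injEq]
  split_ifs
  exacts [(hr _).symm, (hr' _).symm]

namespace Circuit

lemma Computes.apply_mem_supported (hF : F.Computes hk f)
    (hB : ∀ i, Fin.castLE hk i ∈ F.touched → i ∈ B) {x : Bits n} (hx : x ∈ supported B) :
    f x ∈ supported B :=
  mem_supported.2 fun i hi => by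
    rw [hF.apply_eq_self x fun h => hi (hB i h), mem_supported.1 hx i hi]

lemma Computes.forall_mem_eq_iff (hF : F.Computes hk f)
    (hB : ∀ i, Fin.castLE hk i ∈ F.touched → i ∈ B) {x a : Bits n} (hx : x ∈ supported B)
    (ha : a ∈ supported B) : (∀ i ∈ B, f x i = f a i) ↔ x = a := by
  refine ⟨fun h => f.injective (funext fun i => ?_), fun h i _ => by rw [h]⟩
  by_cases hi : i ∈ B
  · exact h i hi
  · rw [mem_supported.1 (hF.apply_mem_supported hB hx) i hi,
      mem_supported.1 (hF.apply_mem_supported hB ha) i hi]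

/-- Replaces the candidate by the difference of its image and the target. -/
noncomputable def compare (e : Role n k m ⊕ Role n k m ≃ Fin M) (B : Finset (Fin n))
    (F : Circuit k) : Circuit M :=
  F.relabel (evalEmb e) ++ cnots (fun i => e (.inl (target i))) (fun i => e (.inl (cand i))) B

lemma length_compare_le : (compare e B F).length ≤ F.length + B.card := by
  rw [compare, List.length_append, length_relabel]
  linarith [length_cnots_le (fun i => e (.inl (target i))) (fun i => e (.inl (cand i))) B]

lemma preserves_compare :
    (compare e B F).Preserves {q | (∀ j, evalEmb e j ≠ q) ∧ ∀ i, e (.inl (cand i)) ≠ q} := by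
  refine .append ((preserves_compl_touched _).mono ?_) ((preserves_cnots (by simp) B).mono ?_)
  · rintro q ⟨hq, -⟩ h
    rw [touched_relabel, Finset.mem_coe, Finset.mem_map] at h
    obtain ⟨j, -, hj⟩ := h
    exact hq j hj
  · rintro q ⟨-, hq⟩ ⟨i, -, hi⟩
    exact hq i hi

lemma apply_cand_of_run_compare_ne_zero (hF : F.Computes hk f) {x : Bits n} {u v : Bits M}
    (hu : u ∘ evalEmb e = padZero k x) (hv : run (compare e B F) (ket u) v ≠ 0) {i : Fin n}
    (hi : i ∈ B) : v (e (.inl (cand i))) = f x i + u (e (.inl (target i))) := by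
  rw [compare, run_append] at hv
  obtain ⟨w, hw, hvw⟩ := exists_run_ket_ne_zero hv
  obtain ⟨v', hv', rfl⟩ := exists_of_run_relabel_ket_ne_zero hw
  have extend_cand : Function.extend (evalEmb e) v' u (e (.inl (cand i))) = f x i := by
    rw [hu] at hv'
    rw [← evalEmb_castLE (hk := hk), (evalEmb e).injective.extend_apply, hF.apply_eq hv']
  have extend_target (j : Fin n) : Function.extend (evalEmb e) v' u (e (.inl (target j))) =
      u (e (.inl (target j))) :=
    Function.extend_apply' _ _ _ fun ⟨j, hj⟩ => evalEmb_ne (by simp) (by simp) j hj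
  rw [run_cnots_ket (by simp)] at hvw
  rw [eq_of_ket_ne_zero hvw, Pi.add_apply, extend_cand, Finset.sum_apply]
  simp [Pi.single_apply, extend_target, hi]

/-- The roles of the qubits on which the guess acts nontrivially. -/
def active (B : Finset (Fin n)) (G : Circuit m) (hm : n + n ≤ m) : Finset (Role n k m) :=
  B.image cand ∪ (usedByPredict B G hm).image pred

/-- The qubits without a role in `S`. -/
def inactive (e : Role n k m ⊕ Role n k m ≃ Fin M) (S : Finset (Role n k m)) : Set (Fin M) :=
  {q | ∀ r ∈ S, e (.inl r) ≠ q}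

lemma card_active_le : (active B G hm : Finset (Role n k m)).card ≤ 3 * B.card + 2 * G.length := by
  have := B.card_image_le (f := (cand : Fin n → Role n k m))
  have := (usedByPredict B G hm).card_image_le (f := (pred : Fin m → Role n k m))
  have := card_usedByPredict_le (B := B) (G := G) (hm := hm)
  have := Finset.card_union_le (B.image (cand : Fin n → Role n k m))
    ((usedByPredict B G hm).image pred)
  rw [active]
  lia

lemma preserves_guess : (guess e B G hm hm₁).Preserves (inactive e (active B G hm)) := by
  refine .conj ((preserves_compl_touched _).mono ?_) (preserves_query.mono ?_)
  · rw [touched_hads]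
    rintro q hq h
    obtain ⟨i, hi, rfl⟩ := Finset.mem_map.1 h
    exact hq (cand i) (by simp [active, hi]) rfl
  · rintro q hq h
    obtain ⟨i, hi, rfl⟩ := Finset.mem_map.1 h
    exact hq (pred i) (by simp [active, hi]) rfl

/-- The guess together with a flag which is zero with probability one half; this keeps the success
probability away from one. -/
noncomputable def halvedGuess (e : Role n k m ⊕ Role n k m ≃ Fin M) (B : Finset (Fin n))
    (G : Circuit m) (hm : n + n ≤ m) (hm₁ : 1 ≤ m) : Circuit M :=
  guess e B G hm hm₁ ++ [Gate.had (e (.inl flag))]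

lemma preserves_halvedGuess :
    (halvedGuess e B G hm hm₁).Preserves (inactive e (insert flag (active B G hm))) := by
  refine .append (preserves_guess.mono fun q hq r hr => hq r (Finset.mem_insert_of_mem hr))
    ((preserves_compl_touched _).mono ?_)
  rintro q hq h
  have : q = e (.inl flag) := by simpa [touched, Gate.touched, Gate.had] using h
  exact hq flag (Finset.mem_insert_self _ _) this.symm

lemma apply_inl_of_eqOn {S : Finset (Role n k m)} {b : Role n k m → ZMod 2} {u : Bits M}
    (hu : Set.EqOn (place e b) u (inactive e S)) {r : Role n k m} (hr : r ∉ S) :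
    u (e (.inl r)) = b r := by
  rw [← hu, place_inl]
  intro r' hr' h
  obtain rfl := Sum.inl_injective (e.injective h)
  exact hr hr'

lemma apply_inr_of_eqOn {S : Finset (Role n k m)} {b : Role n k m → ZMod 2} {u : Bits M}
    (hu : Set.EqOn (place e b) u (inactive e S)) (r : Role n k m) : u (e (.inr r)) = 0 := by
  rw [← hu, place_inr]
  exact fun r' _ h => by simpa using e.injective h

lemma run_reflect_ket {z : Bits n} {u : Bits M}
    (hu : Set.EqOn (place e (bitsOf 0 z 0)) u (inactive e (insert flag (active B G hm)))) :
    run (zeroSign e.toEmbedding flag (active B G hm)) (ket u) =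
      (if u = place e (bitsOf 0 z 0) then -1 else 1 : ℂ) • ket u := by
  have bitsOf_eq_zero {r : Role n k m} (hr : r ∈ insert flag (active B G hm)) :
      bitsOf 0 z 0 r = 0 := by
    cases r <;> simp_all [active, bitsOf]
  rw [run_zeroSign_ket (by simp [active]) fun r _ => apply_inr_of_eqOn hu r]
  congr 2
  refine propext ⟨fun h => bits_ext (e := e) (fun r => ?_) fun r => ?_, ?_⟩
  · rw [place_inl]
    by_cases hr : r ∈ insert flag (active B G hm)
    · exact (h r hr).trans (bitsOf_eq_zero hr).symm
    · exact apply_inl_of_eqOn hu hr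
  · rw [apply_inr_of_eqOn hu, place_inr]
  · rintro rfl r hr
    exact (place_inl _ r).trans (bitsOf_eq_zero hr)

/-- Changes the sign of the states with flag zero whose candidate is mapped to the target. -/
noncomputable def mark (e : Role n k m ⊕ Role n k m ≃ Fin M) (B : Finset (Fin n))
    (F : Circuit k) : Circuit M :=
  conj (compare e B F) (zeroSign e.toEmbedding flag (B.image cand))

lemma run_mark_ket (hF : F.Computes hk f)
    (hB : ∀ i, Fin.castLE hk i ∈ F.touched → i ∈ B) {a : Bits n} (ha : a ∈ supported B)
    {u : Bits M}
    (hu : Set.EqOn (place e (bitsOf 0 (f a) 0)) u (inactive e (insert flag (active B G hm)))) :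
    run (mark e B F) (ket u) =
      (if u (e (.inl flag)) = 0 ∧ ∀ i, u (e (.inl (cand i))) = a i then -1 else 1 : ℂ) •
        ket u := by
  set x : Bits n := fun i => u (e (.inl (cand i)))
  have hx : x ∈ supported B := mem_supported.2 fun i hi =>
    apply_inl_of_eqOn hu (r := cand i) (by simpa [active] using hi)
  have comp_evalEmb : u ∘ evalEmb e = padZero k x := by
    ext j
    rw [Function.comp_apply, evalEmb_apply, padZero]
    split_ifs
    · rfl
    · exact apply_inl_of_eqOn hu (by simp [active])
  refine run_conj_ket fun v hv => ?_
  have apply_eq {q : Fin M} (h : ∀ j, evalEmb e j ≠ q) (h' : ∀ i, e (.inl (cand i)) ≠ q) :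
      v q = u q := (preserves_compare hv ⟨h, h'⟩).symm
  have apply_inr (r : Role n k m) : v (e (.inr r)) = 0 := by
    rw [apply_eq (by simp [evalEmb_apply]) (by simp), apply_inr_of_eqOn hu]
  have apply_cand (i : Fin n) (hi : i ∈ B) : v (e (.inl (cand i))) = f x i + f a i := by
    rw [apply_cand_of_run_compare_ne_zero hF comp_evalEmb hv hi,
      apply_inl_of_eqOn hu (by simp [active]), bitsOf]
  have apply_flag : v (e (.inl flag)) = u (e (.inl flag)) :=
    apply_eq (evalEmb_ne (by simp) (by simp)) (by simp)
  rw [run_zeroSign_ket (by simp) fun r _ => apply_inr r]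
  congr 2
  rw [eq_iff_iff, Finset.forall_mem_insert, Finset.forall_mem_image, Equiv.coe_toEmbedding,
    apply_flag, ← funext_iff (f := x), ← hF.forall_mem_eq_iff hB hx ha]
  refine and_congr_right' (forall₂_congr fun i hi => ?_)
  rw [apply_cand i hi, CharTwo.add_eq_zero]

end Circuit

end Inverter

section SizeBound

variable {n k m M : ℕ} {e : Role n k m ⊕ Role n k m ≃ Fin M} {B : Finset (Fin n)}
  {F : Circuit k} {hk : n ≤ k} {f : Equiv.Perm (Bits n)}
  {G : Circuit m} {hm : n + n ≤ m} {hm₁ : 1 ≤ m}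

open Role

namespace Circuit

/-- The strings in which the flag is zero and the candidate is `a`. -/
def Marked (e : Role n k m ⊕ Role n k m ≃ Fin M) (a : Bits n) (w : Bits M) : Prop :=
  w (e (.inl flag)) = 0 ∧ ∀ i, w (e (.inl (cand i))) = a i

instance (a : Bits n) : DecidablePred (Marked e a) := fun _ => inferInstanceAs (Decidable (_ ∧ _))

lemma isAmplifier (hF : F.Computes hk f) (hB : ∀ i, Fin.castLE hk i ∈ F.touched → i ∈ B)
    {a : Bits n} (ha : a ∈ supported B) :
    IsAmplifier (halvedGuess e B G hm hm₁) (mark e B F)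
      (zeroSign e.toEmbedding flag (active B G hm)) (place e (bitsOf 0 (f a) 0))
      (inactive e (insert flag (active B G hm))) (Marked e a) where
  preserves := preserves_halvedGuess
  run_mark _ hu := run_mark_ket hF hB ha hu
  run_reflect _ hu := run_reflect_ket hu

lemma prob_halvedGuess (z a : Bits n) :
    prob (run (halvedGuess e B G hm hm₁) (ket (place e (bitsOf 0 z 0)))) (Marked e a) =
      prob (run (guess e B G hm hm₁) (ket (place e (bitsOf 0 z 0))))
        (fun w => ∀ i, w (e (.inl (cand i))) = a i) / 2 := by
  rw [halvedGuess, run_append]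
  refine prob_apply_had (fun w hw => ?_) _
  exact apply_inl_of_eqOn (preserves_guess hw) (r := flag) (by simp [active])

lemma prob_halvedGuess_le (z a : Bits n) :
    prob (run (halvedGuess e B G hm hm₁) (ket (place e (bitsOf 0 z 0)))) (Marked e a) ≤ 1 / 2 := by
  rw [prob_halvedGuess]
  gcongr
  exact prob_run_ket_le_one _ _ _

lemma sq_le_prob_halvedGuess (hB : ∀ i, secondInput hm i ∈ G.touched → i ∈ B) {a : Bits n}
    (ha : a ∈ supported B) (hfa : f a ∈ supported B) :
    (2 * G.predProb hm hm₁ f a - 1) ^ 2 / 2 ≤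
      prob (run (halvedGuess e B G hm hm₁) (ket (place e (bitsOf 0 (f a) 0)))) (Marked e a) := by
  have sq_norm_run : ‖run (guess e B G hm hm₁) (ket (place e (bitsOf 0 (f a) 0)))
      (place e (bitsOf a (f a) 0))‖ ^ 2 = (2 * G.predProb hm hm₁ f a - 1) ^ 2 := by
    rw [run_guess_ket_place ha hfa, ← two_mul_predProb_sub_one_eq_sum_supported f hB ha,
      Complex.norm_real, Real.norm_eq_abs, sq_abs]
  rw [prob_halvedGuess, ← sq_norm_run]
  gcongr
  exact sq_norm_le_prob _ fun i => place_inl _ _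

/-- The bits of the strings on which the evaluator or the predictor may depend. -/
def relevant (F : Circuit k) (hk : n ≤ k) (G : Circuit m) (hm : n + n ≤ m) : Finset (Fin n) :=
  {i | Fin.castLE hk i ∈ F.touched ∨ secondInput hm i ∈ G.touched}

lemma card_relevant_le : (relevant F hk G hm).card ≤ 2 * (G.length + F.length) := by
  have card_left : (Finset.univ.filter fun i => Fin.castLE hk i ∈ F.touched).card ≤
      F.touched.card :=
    Finset.card_le_card_of_injOn _ (fun i hi => (Finset.mem_filter.1 hi).2)
      (Fin.castLE_injective hk).injOn
  have card_right : (Finset.univ.filter fun i => secondInput hm i ∈ G.touched).card ≤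
      G.touched.card :=
    Finset.card_le_card_of_injOn _ (fun i hi => (Finset.mem_filter.1 hi).2)
      ((Fin.castLE_injective hm).comp (Fin.natAdd_injective n n)).injOn
  have := Finset.card_union_le (Finset.univ.filter fun i => Fin.castLE hk i ∈ F.touched)
    (Finset.univ.filter fun i => secondInput hm i ∈ G.touched)
  rw [relevant, Finset.filter_or]
  linarith [G.card_touched_le, F.card_touched_le]

/-- The inverter of `f` made from a predictor `G` and an evaluator `F` of `f`, with `j` steps of
amplitude amplification. -/
noncomputable def inverter (e : Role n k m ⊕ Role n k m ≃ Fin M) (F : Circuit k) (hk : n ≤ k)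
    (G : Circuit m) (hm : n + n ≤ m) (hm₁ : 1 ≤ m) (j : ℕ) : Circuit M :=
  load e (relevant F hk G hm) ++
    IsAmplifier.circuit (halvedGuess e (relevant F hk G hm) G hm hm₁)
      (mark e (relevant F hk G hm) F)
      (zeroSign e.toEmbedding flag (active (relevant F hk G hm) G hm)) j

lemma length_halvedGuess_le :
    (halvedGuess e B G hm hm₁).length ≤ 6 * B.card + 2 * G.length + 2 := by
  have := length_predict_le (e := e) (B := B) (G := G) (hm := hm)
  simp only [halvedGuess, guess, query, List.length_append, length_conj, length_hads,
    Finset.card_map, List.length_singleton]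
  lia

lemma length_mark_le : (mark e B F).length ≤ 16 * B.card + 2 * F.length + 3 := by
  have := length_compare_le (e := e) (B := B) (F := F)
  have := length_zeroSign_le (e := e.toEmbedding) flag (B.image cand)
  have := B.card_image_le (f := (cand : Fin n → Role n k m))
  rw [mark, length_conj]
  lia

lemma length_inverter_le (h : 1 ≤ G.length + F.length) (j : ℕ) :
    (inverter e F hk G hm hm₁ j).length ≤ 182 * (G.length + F.length) * (j + 1) := by
  have card_B := card_relevant_le (F := F) (hk := hk) (G := G) (hm := hm)
  rw [inverter]
  set B := relevant F hk G hm
  have := length_load_le (e := e) (B := B)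
  have := length_halvedGuess_le (e := e) (B := B) (G := G) (hm := hm) (hm₁ := hm₁)
  have := length_mark_le (e := e) (B := B) (F := F)
  have := length_zeroSign_le (e := e.toEmbedding) flag (active B G hm)
  have := card_active_le (k := k) (B := B) (G := G) (hm := hm)
  rw [List.length_append, IsAmplifier.length_circuit, ← add_assoc, mul_add_one, add_comm,
    mul_comm _ j]
  gcongr <;> lia

lemma sin_sq_le_outProb_inverter (hF : F.Computes hk f) {ε : ℝ} (hε : 0 < ε) {a : Bits n}
    (ha : 1 / 2 + ε ≤ G.predProb hm hm₁ f a) (he : ∀ i, (e (.inl (cand i)) : ℕ) = i)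
    (hM : n ≤ M) :
    ∃ θ : ℝ, Real.pi * ε < 4 * θ ∧ θ ≤ Real.pi / 4 ∧ ∀ j : ℕ,
      Real.sin ((2 * j + 1) * θ) ^ 2 ≤ (inverter e F hk G hm hm₁ j).outProb hM hM (f a) a := by
  set B := relevant F hk G hm with B_def
  have hBF (i : Fin n) (hi : Fin.castLE hk i ∈ F.touched) : i ∈ B := by simp [B_def, relevant, hi]
  have hBG (i : Fin n) (hi : secondInput hm i ∈ G.touched) : i ∈ B := by simp [B_def, relevant, hi]
  have predProb_ne : G.predProb hm hm₁ f a ≠ 1 / 2 := by linarith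
  have a_mem : a ∈ supported B := mem_supported.2 fun i hi =>
    apply_eq_zero_of_predProb_ne predProb_ne fun h => hi (hBG i h)
  have fa_mem : f a ∈ supported B := hF.apply_mem_supported hBF a_mem
  have le_prob := sq_le_prob_halvedGuess (e := e) (hm₁ := hm₁) hBG a_mem fa_mem
  obtain ⟨θ, hε_lt, hθ_le, hθ⟩ := exists_sin_sq_eq hε
    (le_trans (by nlinarith) le_prob) (prob_halvedGuess_le (f a) a)
  refine ⟨θ, hε_lt, hθ_le, fun j => ?_⟩
  have θ_pos : 0 < θ := by linarith [mul_pos Real.pi_pos hε]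
  rw [outProb_eq_prob, inverter, run_append, padZero_eq_place he hM, run_load_ket fa_mem,
    ← (isAmplifier hF hBF a_mem).prob_circuit θ_pos (by linarith [Real.pi_pos]) hθ.symm j]
  refine prob_mono _ fun w hw i => ?_
  rw [← hw.2 i]
  exact congrArg w (Fin.ext (he i).symm)

lemma invProb_nonneg (C : Circuit m) (hm : n ≤ m) (f : Equiv.Perm (Bits n)) :
    0 ≤ C.invProb hm f :=
  div_nonneg (Finset.sum_nonneg fun _ _ => outProb_nonneg _ _ _ _ _) (by positivity)

lemma Computes.invProb_eq_one (hF : F.Computes hk f) (h : F.length = 0) : F.invProb hk f = 1 := by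
  have apply_eq_self (a : Bits n) : f a = a := funext fun i =>
    hF.apply_eq_self a (by simp [List.length_eq_zero_iff.1 h, touched])
  have outProb_eq_one (a : Bits n) : F.outProb hk hk (f a) a = 1 := by
    rw [apply_eq_self]
    exact (congrArg (F.outProb hk hk a) (apply_eq_self a)).symm.trans (hF a)
  simp [invProb, outProb_eq_one]

lemma length_inverter_mul_le (h : 1 ≤ G.length + F.length) {ε : ℝ} (hε : 0 < ε) (hε' : ε ≤ 1)
    {j : ℕ} (hj : j ≤ ⌊1 / ε⌋₊) :
    (inverter e F hk G hm hm₁ j).length * ε ≤ 364 * (G.length + F.length) := by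
  have length_le : ((inverter e F hk G hm hm₁ j).length : ℝ) ≤
      182 * (G.length + F.length) * (j + 1) := by exact_mod_cast length_inverter_le h j
  have mul_le : j * ε ≤ 1 :=
    (le_div_iff₀ hε).1 ((Nat.le_floor_iff (by positivity)).1 hj)
  calc (inverter e F hk G hm hm₁ j).length * ε
      ≤ 182 * (G.length + F.length) * (j + 1) * ε := by gcongr
    _ = 182 * (G.length + F.length) * (j * ε + ε) := by ring
    _ ≤ 182 * (G.length + F.length) * (1 + 1) := by gcongr
    _ = 364 * (G.length + F.length) := by ring

lemma exists_card_div_two_le_invProb (hF : F.Computes hk f) {ε : ℝ} (hε : 0 < ε)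
    {Y : Finset (Bits n)} (hY : ∀ y ∈ Y, 1 / 2 + ε ≤ G.predProb hm hm₁ f y) (hY₀ : Y.Nonempty)
    (h : 1 ≤ G.length + F.length) :
    ∃ (M : ℕ) (hM : n ≤ M) (C : Circuit M),
      C.length * ε ≤ 364 * (G.length + F.length) ∧ Y.card / 2 ^ n / 2 ≤ C.invProb hM f := by
  obtain ⟨M, hM, e, he⟩ := exists_equiv_fin_extending (X := Role n k m ⊕ Role n k m)
    ⟨fun i => .inl (cand i), fun i j h => by simpa using h⟩
  have exists_angle (y : Bits n) (hy : y ∈ Y) :=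
    sin_sq_le_outProb_inverter (e := e) hF hε (hY y hy) he hM
  choose! θ hε_lt hθ_le sin_sq_le using exists_angle
  have hε_le : ε ≤ 1 := by
    obtain ⟨y, hy⟩ := hY₀
    nlinarith [hε_lt y hy, hθ_le y hy, Real.pi_pos]
  have lt_floor : 1 < (⌊1 / ε⌋₊ + 1) * ε := (div_lt_iff₀ hε).1 (Nat.lt_floor_add_one _)
  have angle_lt (y : Bits n) (hy : y ∈ Y) : Real.pi / (⌊1 / ε⌋₊ + 1) < 4 * θ y := by
    refine lt_trans ?_ (hε_lt y hy)
    rw [div_lt_iff₀ (by positivity)]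
    nlinarith [Real.pi_pos]
  obtain ⟨j, hj, card_le⟩ := exists_card_div_two_le_sum_sin_sq Y θ
    (Nat.floor_pos.2 ((le_div_iff₀ hε).2 (by linarith))) angle_lt hθ_le
  refine ⟨M, hM, inverter e F hk G hm hm₁ j, length_inverter_mul_le h hε hε_le hj, ?_⟩
  rw [div_right_comm, invProb]
  gcongr
  refine (card_le.trans (Finset.sum_le_sum fun y hy => sin_sq_le y hy j)).trans ?_
  exact Finset.sum_le_univ_sum_of_nonneg fun _ => outProb_nonneg _ _ _ _ _

lemma exists_le_invProb (hF : F.Computes hk f) {δ ε : ℝ} (hG : G.Predicts hm hm₁ f δ ε)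
    (hε : 0 < ε) :
    ∃ (M : ℕ) (hM : n ≤ M) (C : Circuit M),
      C.length * ε ≤ 364 * (G.length + F.length) ∧ δ / 2 ≤ C.invProb hM f := by
  let Y : Finset (Bits n) := {y | 1 / 2 + ε ≤ G.predProb hm hm₁ f y}
  have δ_le : δ ≤ Y.card / 2 ^ n := by
    rw [Predicts, Set.ncard_eq_toFinset_card'] at hG
    simpa [Y] using hG
  rcases Y.eq_empty_or_nonempty with hY | hY
  · refine ⟨n, le_rfl, [], by rw [List.length_nil, Nat.cast_zero, zero_mul]; positivity, ?_⟩
    rw [hY, Finset.card_empty, Nat.cast_zero, zero_div] at δ_le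
    linarith [invProb_nonneg [] le_rfl f]
  rcases (G.length + F.length).eq_zero_or_pos with h | h
  · have card_le : (Y.card : ℝ) / 2 ^ n ≤ 1 := by
      rw [div_le_one (by positivity)]
      exact_mod_cast Y.card_le_univ.trans_eq (by simp)
    refine ⟨k, hk, F, by simp [Nat.eq_zero_of_add_eq_zero_left h], ?_⟩
    rw [hF.invProb_eq_one (Nat.eq_zero_of_add_eq_zero_left h)]
    linarith
  · obtain ⟨M, hM, C, length_le, le_invProb⟩ :=
      exists_card_div_two_le_invProb hF hε (fun y hy => (Finset.mem_filter.1 hy).2) hY h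
    exact ⟨M, hM, C, length_le, by linarith⟩

end Circuit

lemma size_lower_bound {δ ε : ℝ} {T : ℕ} (hf : QHardToInvert f (δ / 2) T)
    (hF : F.Computes hk f) (hG : G.Predicts hm hm₁ f δ ε) :
    1 / 364 * (T : ℝ) * ε ≤ G.size + F.size := by
  by_contra! h
  have hε : 0 < ε := by
    by_contra! hε
    have : 0 ≤ (G.size + F.size : ℝ) := by positivity
    nlinarith [mul_nonneg (Nat.cast_nonneg (α := ℝ) T) (neg_nonneg.2 hε)]
  obtain ⟨M, hM, C, length_le, le_invProb⟩ := Circuit.exists_le_invProb hF hG hε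
  refine hf ⟨M, hM, C, ?_, le_invProb⟩
  have : (C.length : ℝ) * ε < T * ε := by
    rw [Circuit.size, Circuit.size] at h
    linarith
  exact_mod_cast (lt_of_mul_lt_mul_right this hε.le).le

end SizeBound

end QuantumGL

theorem theorem4 :
    ∃ c : ℝ, 0 < c ∧
      ∀ (n : ℕ) (f : Equiv.Perm (QuantumGL.Bits n)) (δ ε : ℝ) (T : ℕ)
        (k : ℕ) (hk : n ≤ k) (F : QuantumGL.Circuit k)
        (m : ℕ) (hm : n + n ≤ m) (hm₁ : 1 ≤ m) (G : QuantumGL.Circuit m),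
        QuantumGL.QHardToInvert f (δ / 2) T →
        QuantumGL.Circuit.Computes F hk f →
        QuantumGL.Circuit.Predicts G hm hm₁ f δ ε →
        c * (T : ℝ) * ε ≤ (QuantumGL.Circuit.size G : ℝ) + (QuantumGL.Circuit.size F : ℝ) ∧
        ((QuantumGL.Circuit.size F : ℝ) ≤ c / 2 * (T : ℝ) * ε →
          c / 2 * (T : ℝ) * ε ≤ (QuantumGL.Circuit.size G : ℝ)) := by
  refine ⟨1 / 364, by norm_num, fun n f δ ε T k hk F m hm hm₁ G hf hF hG => ?_⟩
  have lower_bound := QuantumGL.size_lower_bound hf hF hG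
  exact ⟨lower_bound, fun hS => by linarith⟩
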